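/- Let $N=3$ and let $\eta=(\eta_{\alpha\beta})$ be any real symmetric nondegenerate $3\times 3$ matrix, with inverse $(\eta^{\alpha\beta})$. For a function $F(t^1,t^2,t^3)$ with $F_{1\alpha\beta}=\eta_{\alpha\beta}$ (subscripts denote third partial derivatives; $F$ is of class $C^4$ on an open set) the WDVV system is $$S_{\alpha\beta\gamma\nu}:=\eta^{\lambda\mu}(F_{\lambda\alpha\beta}F_{\mu\gamma\nu}-F_{\lambda\alpha\nu}F_{\mu\gamma\beta})=0,\qquad \alpha,\beta,\gamma,\nu=1,2,3.$$ Let $\psi^1_{kh}=\psi^2_{kh}=0$, let $\psi^3_{kh}$ be skew-symmetric with $\psi^3_{12}=-\eta^{22}$, $\psi^3_{13}=-\eta^{23}$, $\psi^3_{23}=-\eta^{33}$, and let $$\Omega=\begin{pmatrix}1&0&0\\0&1&0\\-\eta^{12}\eta_{23}&\eta^{12}\eta_{22}-\eta^{13}\eta_{23}&\eta^{13}\eta_{22}\end{pmatrix},\quad \Theta=\begin{pmatrix}0&1&0\\0&0&1\\-\eta^{12}\eta_{33}&\eta^{12}\eta_{23}-\eta^{13}\eta_{33}&\eta^{13}\eta_{23}\end{pmatrix},$$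 $$\xi=\begin{pmatrix}0\\0\\-\eta^{11}(\eta_{22}\eta_{33}-\eta_{23}^2)\end{pmatrix},\quad \phi=\begin{pmatrix} \eta^{11}\eta^{22}-(\eta^{12})^2&\eta^{11}\eta^{23}-\eta^{12}\eta^{13}&\eta^{12}\eta^{23}-\eta^{13}\eta^{22}\\ \eta^{11}\eta^{23}-\eta^{12}\eta^{13}&\eta^{11}\eta^{33}-(\eta^{13})^2&\eta^{12}\eta^{33}-\eta^{13}\eta^{23}\\ \eta^{12}\eta^{23}-\eta^{13}\eta^{22}&\eta^{12}\eta^{33}-\eta^{13}\eta^{23}&\eta^{22}\eta^{33}-(\eta^{23})^2\end{pmatrix}.$$ Choose $p\in\{2,3\}$ and let $q$ be the other element of $\{2,3\}$. Put $u=(F_{p22},F_{p23},F_{p33})$ and $v=(F_{q22},F_{q23},F_{q33})$; put $(\omega,\theta,\zeta)=(\Omega,\Theta,\xi)$ if $p=2$ and $(\omega,\theta,\zeta)=(\Theta,\Omega,-\xi)$ if $p=3$. Consider the linear line congruence $$\tfrac12\psi^\gamma_{km}(u^mv^k-u^kv^m)+\omega^\gamma_kv^k-\theta^\gamma_mu^m-\zeta^\gamma=0,\qquad\gamma=1,2,3,\qquad(*)$$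 and let $\psi^\gamma_i(u)=\psi^\gamma_{ik}u^k+\omega^\gamma_i$ and $U=\{u\in\mathbb R^3:\det(\psi^\gamma_i(u))\ne0\}$. Then: 1. $\phi$ is nondegenerate, and $(\psi^\gamma_i)$ is (generically) nondegenerate: $U$ is open and dense in $\mathbb R^3$. 2. For $F$ as above, the WDVV system is equivalent to $(*)$. For $u\in U$ and $v\in\mathbb R^3$, $(*)$ is equivalent to $v=V(u)$, where $V^i=\psi^i_\gamma Z^\gamma$, $(\psi^i_\gamma)=(\psi^\gamma_i)^{-1}$, $Z^\gamma=\theta^\gamma_ku^k+\zeta^\gamma$. Thus the WDVV system is rewritten as the system of conservation laws $$\partial_{t^q}u^I=\partial_{t^p}\big(V^I(u)\big),\qquad I=1,2,3:\qquad(**)$$ if $F$ as above solves the WDVV system, then $u=(F_{p22},F_{p23},F_{p33})$ satisfies $(**)$ at all points where $u\in U$; conversely, on a convex open set every $C^1$ solution $u$ of $(**)$ with values in $U$ and independent of $t^1$ is $(F_{p22},F_{p23},F_{p33})$ for some $F$ as above that solves the WDVV system. 3. Let $f_{ij}=\phi_{\alpha\beta}\psi^\alpha_i\psi^\beta_j$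 (a symmetric matrix that is nondegenerate on $U$), let $(f^{ij})$ be its inverse, $c_{skm}=\frac13(f_{sm,k}-f_{sk,m})$, and define $c^{ij}_k$ by $c_{ijk}=f_{iq}f_{jp}c^{pq}_k$. With $x=t^p$, the third-order operator $A^{ij}=D_x\circ(f^{ij}D_x+c^{ij}_ku^k_x)\circ D_x$ is Hamiltonian for fields $u$ with values in $U$: the bracket $\{P,Q\}=\int\frac{\delta P}{\delta u^i}A^{ij}\frac{\delta Q}{\delta u^j}\,dx$ of local functionals (densities are smooth functions of $x$ and finitely many $x$-derivatives of $u$, taken modulo total $x$-derivatives) is skew-symmetric and satisfies the Jacobi identity. 4. The system $(**)$ is Hamiltonian with respect to $A$, that is, with $t=t^q$, $u^i_t=A^{ij}\frac{\delta H}{\delta u^j}$ for a functional $H=\int h\,dx$ whose density $h$ is a smooth function of $x$, of the potentials $b^j$ with $b^j_x=u^j$, and of finitely many of their $x$-derivatives. Here $D_x\frac{\delta H}{\delta u^j}=-\frac{\delta H}{\delta b^j}$, so this means $D_x\big(V^i(b_x)\big)=-D_x\big((f^{ij}(b_x)D_x+c^{ij}_k(b_x)b^k_{xx})\frac{\delta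 H}{\delta b^j}\big)$. -/

import Mathlib

open scoped Matrix

noncomputable section

namespace WDVV

/-! ### Differential functions, total derivative, variational derivatives -/

/-- Points `(x, (u^i_k)_{k, i})` of the infinite jet space of curves `x ↦ u(x) ∈ ℝⁿ`;
`q.2 k i` is the coordinate `u^i_k = ∂_x^k u^i`. -/
abbrev Jet (n : ℕ) : Type := ℝ × (ℕ → Fin n → ℝ)

variable {n : ℕ}

/-- The jet of order less than `k`. -/
def jetTrunc (k : ℕ) (q : Jet n) : ℝ × (Fin k → Fin n → ℝ) := (q.1, fun j => q.2 j)

/-- `P` is a differential function on `Ω`: a smooth function of `x` and of finitely many of the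
jet coordinates. -/
def IsDiffFun (Ω : Set (Jet n)) (P : Jet n → ℝ) : Prop :=
  ∃ (k : ℕ) (p : ℝ × (Fin k → Fin n → ℝ) → ℝ),
    ContDiffOn ℝ (⊤ : ℕ∞) p (jetTrunc k '' Ω) ∧ ∀ q ∈ Ω, P q = p (jetTrunc k q)

/-- The partial derivative `∂P/∂x`. -/
def partialX (P : Jet n → ℝ) : Jet n → ℝ := fun q => deriv (fun s => P (s, q.2)) q.1

/-- The partial derivative `∂P/∂u^i_k`. -/
def partialU (k : ℕ) (i : Fin n) (P : Jet n → ℝ) : Jet n → ℝ := fun q =>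
  deriv (fun s => P (q.1, Function.update q.2 k (Function.update (q.2 k) i s))) (q.2 k i)

/-- The total derivative `D_x P = ∂P/∂x + ∑ u^i_{k+1} ∂P/∂u^i_k` (a finite sum for differential
functions). -/
def totalD (P : Jet n → ℝ) : Jet n → ℝ := fun q =>
  partialX P q + ∑ᶠ k : ℕ, ∑ i : Fin n, q.2 (k + 1) i * partialU k i P q

/-- The variational derivative `δ/δu^i ∫ P dx = ∑ (-D_x)^k ∂P/∂u^i_k` (a finite sum for
differential functions). -/
def varD (i : Fin n) (P : Jet n → ℝ) : Jet n → ℝ := fun q =>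
  ∑ᶠ k : ℕ, (-1 : ℝ) ^ k * (totalD^[k] (partialU k i P)) q

/-- `∫ P dx = 0` as a local functional on `Ω`: the density `P` is a total derivative. -/
def IsTotalDerivative (Ω : Set (Jet n)) (P : Jet n → ℝ) : Prop :=
  ∃ T : Jet n → ℝ, IsDiffFun Ω T ∧ ∀ q ∈ Ω, P q = totalD T q

/-! ### Hamiltonian operators -/

/-- A density of the bracket `{∫P, ∫Q}_A = ∫ (δP/δu^i) A^{ij} (δQ/δu^j) dx`. -/
def bracket (A : (Fin n → Jet n → ℝ) → Fin n → Jet n → ℝ) (P Q : Jet n → ℝ) : Jet n → ℝ :=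
  fun q => ∑ i, varD i P q * A (fun j => varD j Q) i q

/-- `A` is Hamiltonian on `Ω`: its bracket is a Poisson bracket on local functionals, that is, it is
skew-symmetric and satisfies the Jacobi identity modulo total derivatives. -/
def IsHamiltonianOp (Ω : Set (Jet n)) (A : (Fin n → Jet n → ℝ) → Fin n → Jet n → ℝ) : Prop :=
  (∀ P Q, IsDiffFun Ω P → IsDiffFun Ω Q →
    IsTotalDerivative Ω (fun q => bracket A P Q q + bracket A Q P q)) ∧
  (∀ P Q R, IsDiffFun Ω P → IsDiffFun Ω Q → IsDiffFun Ω R →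
    IsTotalDerivative Ω (fun q => bracket A (bracket A P Q) R q +
      bracket A (bracket A Q R) P q + bracket A (bracket A R P) Q q))

/-! ### Third-order operators `D_x ∘ (f^{ij} D_x + c^{ij}_k u^k_x) ∘ D_x` in canonical form -/

/-- `c_{skm} = (f_{sm,k} - f_{sk,m}) / 3`, where `f_{ij}` is the (lower-index) metric `f`. -/
def lowerC (f : (Fin n → ℝ) → Matrix (Fin n) (Fin n) ℝ) (u : Fin n → ℝ) (s k m : Fin n) : ℝ :=
  (fderiv ℝ (fun w => f w s m) u (Pi.single k 1) -
    fderiv ℝ (fun w => f w s k) u (Pi.single m 1)) / 3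

/-- `c^{pq}_k`, determined by `c_{ijk} = f_{iq} f_{jp} c^{pq}_k`. -/
def upperC (f : (Fin n → ℝ) → Matrix (Fin n) (Fin n) ℝ) (u : Fin n → ℝ) (p q k : Fin n) : ℝ :=
  ∑ i, ∑ j, (f u)⁻¹ q i * (f u)⁻¹ p j * lowerC f u i j k

/-- The inner first-order operator `π ↦ f^{ij}(u) D_x π_j + c^{ij}_k(u) u^k_x π_j`, where `u = u(q)`
and `u_x = u₁(q)` are given as functions on the jet space on which `D_x` acts. -/
def innerOp (f : (Fin n → ℝ) → Matrix (Fin n) (Fin n) ℝ) (u u₁ : Jet n → Fin n → ℝ)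
    (π : Fin n → Jet n → ℝ) (i : Fin n) : Jet n → ℝ := fun q =>
  ∑ j, ((f (u q))⁻¹ i j * totalD (π j) q + (∑ k, upperC f (u q) i j k * u₁ q k) * π j q)

/-- The third-order operator `D_x ∘ (f^{ij} D_x + c^{ij}_k u^k_x) ∘ D_x` defined by `f`. -/
def thirdOrderOp (f : (Fin n → ℝ) → Matrix (Fin n) (Fin n) ℝ)
    (π : Fin n → Jet n → ℝ) (i : Fin n) : Jet n → ℝ :=
  totalD (innerOp f (fun q => q.2 0) (fun q => q.2 1) (fun j => totalD (π j)) i)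

/-- The operator defined by `f` is a (nondegenerate) third-order Hamiltonian operator for fields
`u` with values in `U`. -/
def IsThirdOrderHamiltonian (U : Set (Fin n → ℝ))
    (f : (Fin n → ℝ) → Matrix (Fin n) (Fin n) ℝ) : Prop :=
  (∀ u ∈ U, (f u).IsSymm ∧ (f u).det ≠ 0) ∧
  IsHamiltonianOp {q : Jet n | q.2 0 ∈ U} (thirdOrderOp f)

/-- The system `u^i_t = (V^i(u))_x` has the form `u^i_t = A^{ij} δH/δu^j` for the third-order
operator `A` defined by `f`.  The functional `H` is local in the potentials `b`, `b_x = u`; since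
`δ/δb = -D_x ∘ δ/δu`, one has `D_x (δH/δu^j) = -δH/δb^j`, so that
`A^{ij} δH/δu^j = D_x ((f^{ij} D_x + c^{ij}_k u^k_x) (-δH/δb^j))`.  Points of the jet space are here
jets of `b`, so that `u = q.2 1` and `u_x = q.2 2`. -/
def IsHamiltonianSystem (U : Set (Fin n → ℝ)) (f : (Fin n → ℝ) → Matrix (Fin n) (Fin n) ℝ)
    (V : (Fin n → ℝ) → Fin n → ℝ) : Prop :=
  ∃ h : Jet n → ℝ, IsDiffFun {q : Jet n | q.2 1 ∈ U} h ∧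
    ∀ q : Jet n, q.2 1 ∈ U → ∀ i,
      totalD (fun r => V (r.2 1) i) q =
        totalD (innerOp f (fun r => r.2 1) (fun r => r.2 2) (fun j r => -varD j h r) i) q

/-! ### Linear line congruences -/

/-- The coefficients of a system of `n` linear equations in the Plücker coordinates
`u^m v^k - u^k v^m`, `v^k`, `u^m`, `1` of the lines through `(u, 1, 0)` and `(v, 0, 1)`. -/
structure LineCongruence (n : ℕ) where
  psi : Fin n → Matrix (Fin n) (Fin n) ℝ
  omega : Matrix (Fin n) (Fin n) ℝ
  theta : Matrix (Fin n) (Fin n) ℝ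
  xi : Fin n → ℝ

namespace LineCongruence

/-- The equations
`½ ψ^γ_{km} (u^m v^k - u^k v^m) + ω^γ_k v^k - θ^γ_m u^m - ξ^γ = 0`, for all `γ`. -/
def Holds (C : LineCongruence n) (u v : Fin n → ℝ) : Prop :=
  ∀ γ, 1 / 2 * ∑ k, ∑ m, C.psi γ k m * (u m * v k - u k * v m) + ∑ k, C.omega γ k * v k
    - ∑ m, C.theta γ m * u m - C.xi γ = 0

/-- The matrix `ψ^γ_i(u) = ψ^γ_{ik} u^k + ω^γ_i`. -/
def psiMat (C : LineCongruence n) (u : Fin n → ℝ) : Matrix (Fin n) (Fin n) ℝ :=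
  Matrix.of fun γ i => ∑ k, C.psi γ i k * u k + C.omega γ i

/-- The set of `u` at which `(ψ^γ_i(u))` is invertible. -/
def regular (C : LineCongruence n) : Set (Fin n → ℝ) := {u | (C.psiMat u).det ≠ 0}

/-- The fluxes `V^i = ψ^i_γ Z^γ`, where `(ψ^i_γ)` is the inverse of `(ψ^γ_i)` and
`Z^γ = θ^γ_k u^k + ξ^γ`. -/
def flux (C : LineCongruence n) (u : Fin n → ℝ) : Fin n → ℝ :=
  (C.psiMat u)⁻¹ *ᵥ (C.theta *ᵥ u + C.xi)

/-- The same equations (up to an overall sign) with the roles of `u` and `v` exchanged. -/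
def swap (C : LineCongruence n) : LineCongruence n where
  psi := C.psi
  omega := C.theta
  theta := C.omega
  xi := -C.xi

/-- The Monge metric `f_{ij} = φ_{αβ} ψ^α_i ψ^β_j`. -/
def monge (C : LineCongruence n) (φ : Matrix (Fin n) (Fin n) ℝ) (u : Fin n → ℝ) :
    Matrix (Fin n) (Fin n) ℝ :=
  (C.psiMat u)ᵀ * φ * C.psiMat u

end LineCongruence

/-! ### The WDVV equations for `N = 3`

The coordinates `t¹, t², t³` are indexed by `0, 1, 2 : Fin 3`; `η a b` is `η_{a+1,b+1}` and
`η⁻¹ a b` is `η^{a+1,b+1}`. -/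

/-- The partial derivative of `G` with respect to the coordinate with index `a`. -/
def pderiv (a : Fin 3) (G : (Fin 3 → ℝ) → ℝ) (t : Fin 3 → ℝ) : ℝ := fderiv ℝ G t (Pi.single a 1)

/-- The third derivative `F_{abc}`. -/
def third (F : (Fin 3 → ℝ) → ℝ) (a b c : Fin 3) (t : Fin 3 → ℝ) : ℝ :=
  pderiv a (pderiv b (pderiv c F)) t

/-- `S_{αβγν} = η^{λμ} (F_{λαβ} F_{μγν} - F_{λαν} F_{μγβ})`. -/
def wdvvS (η : Matrix (Fin 3) (Fin 3) ℝ) (F : (Fin 3 → ℝ) → ℝ) (α β γ ν : Fin 3)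
    (t : Fin 3 → ℝ) : ℝ :=
  ∑ l, ∑ m, η⁻¹ l m * (third F l α β t * third F m γ ν t - third F l α ν t * third F m γ β t)

/-- `F` is of class `C⁴` on `W` and `F_{1αβ} = η_{αβ}`. -/
def IsNormalized (η : Matrix (Fin 3) (Fin 3) ℝ) (W : Set (Fin 3 → ℝ)) (F : (Fin 3 → ℝ) → ℝ) :
    Prop :=
  ContDiffOn ℝ 4 F W ∧ ∀ t ∈ W, ∀ α β, third F 0 α β t = η α β

/-- The WDVV system on `W`. -/
def SolvesWDVV (η : Matrix (Fin 3) (Fin 3) ℝ) (W : Set (Fin 3 → ℝ)) (F : (Fin 3 → ℝ) → ℝ) :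
    Prop :=
  ∀ t ∈ W, ∀ α β γ ν, wdvvS η F α β γ ν t = 0

/-- The field variables `(F_{p22}, F_{p23}, F_{p33})`. -/
def fields (F : (Fin 3 → ℝ) → ℝ) (p : Fin 3) (t : Fin 3 → ℝ) : Fin 3 → ℝ :=
  ![third F p 1 1 t, third F p 1 2 t, third F p 2 2 t]

/-- The system of conservation laws `∂_q u^I = ∂_p (V^I(u))` at the point `t`. -/
def ConservationLawAt (p q : Fin 3) (V : (Fin 3 → ℝ) → Fin 3 → ℝ)
    (u : (Fin 3 → ℝ) → Fin 3 → ℝ) (t : Fin 3 → ℝ) : Prop :=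
  ∀ I, pderiv q (fun s => u s I) t = pderiv p (fun s => V (u s) I) t

/-- The linear line congruence of the WDVV equations (in the order `S_{1223}`, `S_{1233}`,
`S_{2233}`), where `u = (F_{222}, F_{223}, F_{233})` and `v = (F_{322}, F_{323}, F_{333})`. -/
def wdvvCongruence (η : Matrix (Fin 3) (Fin 3) ℝ) : LineCongruence 3 where
  psi := ![0, 0,
    !![0, -η⁻¹ 1 1, -η⁻¹ 1 2;
       η⁻¹ 1 1, 0, -η⁻¹ 2 2;
       η⁻¹ 1 2, η⁻¹ 2 2, 0]]
  omega :=
    !![1, 0, 0;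
       0, 1, 0;
       -(η⁻¹ 0 1 * η 1 2), η⁻¹ 0 1 * η 1 1 - η⁻¹ 0 2 * η 1 2, η⁻¹ 0 2 * η 1 1]
  theta :=
    !![0, 1, 0;
       0, 0, 1;
       -(η⁻¹ 0 1 * η 2 2), η⁻¹ 0 1 * η 1 2 - η⁻¹ 0 2 * η 2 2, η⁻¹ 0 2 * η 1 2]
  xi := ![0, 0, -(η⁻¹ 0 0 * (η 1 1 * η 2 2 - η 1 2 ^ 2))]

/-- The congruence for the choice of the independent variable with index `p`: the one above for
`t²`, and the one with `u` and `v` exchanged for `t³`. -/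
def chosenCongruence (η : Matrix (Fin 3) (Fin 3) ℝ) (p : Fin 3) : LineCongruence 3 :=
  if p = 1 then wdvvCongruence η else (wdvvCongruence η).swap

/-- The matrix `φ`. -/
def phi (η : Matrix (Fin 3) (Fin 3) ℝ) : Matrix (Fin 3) (Fin 3) ℝ :=
  !![η⁻¹ 0 0 * η⁻¹ 1 1 - η⁻¹ 0 1 ^ 2,
      η⁻¹ 0 0 * η⁻¹ 1 2 - η⁻¹ 0 1 * η⁻¹ 0 2,
      η⁻¹ 0 1 * η⁻¹ 1 2 - η⁻¹ 0 2 * η⁻¹ 1 1;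
     η⁻¹ 0 0 * η⁻¹ 1 2 - η⁻¹ 0 1 * η⁻¹ 0 2,
      η⁻¹ 0 0 * η⁻¹ 2 2 - η⁻¹ 0 2 ^ 2,
      η⁻¹ 0 1 * η⁻¹ 2 2 - η⁻¹ 0 2 * η⁻¹ 1 2;
     η⁻¹ 0 1 * η⁻¹ 1 2 - η⁻¹ 0 2 * η⁻¹ 1 1,
      η⁻¹ 0 1 * η⁻¹ 2 2 - η⁻¹ 0 2 * η⁻¹ 1 2,
      η⁻¹ 1 1 * η⁻¹ 2 2 - η⁻¹ 1 2 ^ 2]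

end WDVV

end

open scoped Matrix

noncomputable section

/-! Everything rests on one factorization. Write `ψ(u)` for `psiMat u`, an affine function of `u`.
Since `ψ` is skew in its lower indices, the congruence reads `ψ(u) v = θ u + ξ`, which is solved by
the flux `V` where `ψ(u)` is invertible. If moreover the cyclic sum of `(φψ)_{γi} ψ^γ_{jk}`
vanishes, then `c_{skm} = -(φψ)_{γs} ψ^γ_{km}`, and the inner operator of `A` becomes `ψ⁻¹ φ⁻¹ D
ψ⁻ᵀ`, so that `A = D ψ⁻¹ φ⁻¹ D ψ⁻ᵀ D` (`lowerC_monge`, `sum_monge_inv_add_upperC`).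

Skew-symmetry of the bracket is then visible. For the Jacobi identity (`JetAlgebra.jacobi`), the
bracket is varied along an evolutionary vector field. The terms containing second variations cancel
because variational derivatives have self-adjoint linearization. What remains comes from varying
`ψ`, and one integration by parts reduces it to the cyclic identity. This argument takes place in an
abstract algebra with a total derivative and partial derivatives; smooth functions of finitely many
jet coordinates form such an algebra (`jetAlg`).

For the Hamiltonian, put `s = φ θ b + x φ ξ`, so that `D s = φ (θ u + ξ)`. If `-δH/δb = ψᵀ s`, the
factorized operator returns `D V` at once. Two algebraic conditions, collected in `IsMongeSystem`,
make `ψᵀ s` a variational derivative, and the density is explicit (`varDeriv_energy`).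

For WDVV, the symmetries of `S_{αβγν}` and the normalization of `F` leave the single equation
`S_{2233} = 0`. The other two equations of the congruence are the coincidences `F_{322} = F_{223}`
and `F_{323} = F_{233}` (`wdvv_tensor_iff`). The conservation laws are equalities of mixed partial
derivatives; conversely, they are the closedness conditions that let `F` be recovered by three
applications of the Poincaré lemma. The conditions on `φ`, `ψ`, `ω`, `θ`, `ξ` are polynomial
identities in the entries of `η⁻¹` (`isMongeSystem_wdvv`). -/

namespace WDVV

/-! ### Formal variational calculus in an abstract algebra of differential functions. -/

section

/-- An algebra of differential functions: a total derivative `D` and partial derivatives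
`d k i = ∂/∂u^i_k` with `[∂/∂u^i_{k+1}, D] = ∂/∂u^i_k` and `[∂/∂u^i_0, D] = 0`. -/
structure JetAlgebra (n : ℕ) (R : Type*) [CommRing R] [Algebra ℝ R] where
  D : Derivation ℝ R R
  d : ℕ → Fin n → Derivation ℝ R R
  d_comm : ∀ k i l j P, d k i (d l j P) = d l j (d k i P)
  d_zero_D : ∀ i P, d 0 i (D P) = D (d 0 i P)
  d_succ_D : ∀ k i P, d (k + 1) i (D P) = D (d (k + 1) i P) + d k i P
  exists_order : ∀ P, ∃ K, ∀ k, K ≤ k → ∀ i, d k i P = 0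

namespace JetAlgebra

variable {n : ℕ} {R : Type*} [CommRing R] [Algebra ℝ R] (S : JetAlgebra n R)

lemma exists_common_order (P Q : R) :
    ∃ K, ∀ k, K ≤ k → ∀ i, S.d k i P = 0 ∧ S.d k i Q = 0 := by
  obtain ⟨K, hK⟩ := S.exists_order P
  obtain ⟨L, hL⟩ := S.exists_order Q
  exact ⟨max K L, fun k hk i =>
    ⟨hK k (le_trans (le_max_left _ _) hk) i, hL k (le_trans (le_max_right _ _) hk) i⟩⟩

/-- The prolonged action `∑ D^k X^i ∂/∂u^i_k` of the evolutionary vector field `X`. -/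
def evolveFun (X : Fin n → R) (P : R) : R :=
  ∑ᶠ k : ℕ, ∑ i, S.D^[k] (X i) * S.d k i P

lemma evolveFun_eq_sum (X : Fin n → R) {P : R} {K : ℕ} (h : ∀ k, K ≤ k → ∀ i, S.d k i P = 0) :
    S.evolveFun X P = ∑ k ∈ Finset.range K, ∑ i, S.D^[k] (X i) * S.d k i P := by
  refine finsum_eq_sum_of_support_subset _ fun k hk => ?_
  by_contra hk'
  refine hk (Finset.sum_eq_zero fun i _ => ?_)
  rw [h k (by simpa using hk') i, mul_zero]

/-- The evolutionary derivation with characteristic `X`. -/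
def evolve (X : Fin n → R) : Derivation ℝ R R :=
  Derivation.mk'
    { toFun := S.evolveFun X
      map_add' := fun P Q => by
        obtain ⟨K, hK⟩ := S.exists_common_order P Q
        rw [S.evolveFun_eq_sum X (K := K) fun k hk i => by
            rw [map_add, (hK k hk i).1, (hK k hk i).2, add_zero],
          S.evolveFun_eq_sum X fun k hk i => (hK k hk i).1,
          S.evolveFun_eq_sum X fun k hk i => (hK k hk i).2]
        simp only [map_add, mul_add, Finset.sum_add_distrib]
      map_smul' := fun c P => by
        obtain ⟨K, hK⟩ := S.exists_order P
        rw [S.evolveFun_eq_sum X (K := K) fun k hk i => by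
            rw [Derivation.map_smul, hK k hk i, smul_zero],
          S.evolveFun_eq_sum X hK]
        simp only [Derivation.map_smul, mul_smul_comm, Finset.smul_sum, RingHom.id_apply] }
    fun P Q => by
      obtain ⟨K, hK⟩ := S.exists_common_order P Q
      change S.evolveFun X (P * Q) = P • S.evolveFun X Q + Q • S.evolveFun X P
      rw [S.evolveFun_eq_sum X (K := K) fun k hk i => by
          rw [Derivation.leibniz, (hK k hk i).1, (hK k hk i).2, smul_zero, smul_zero, add_zero],
        S.evolveFun_eq_sum X fun k hk i => (hK k hk i).1,
        S.evolveFun_eq_sum X fun k hk i => (hK k hk i).2]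
      simp only [Derivation.leibniz, smul_eq_mul, Finset.mul_sum, ← Finset.sum_add_distrib]
      refine Finset.sum_congr rfl fun k _ => Finset.sum_congr rfl fun i _ => by ring

lemma evolve_eq_sum (X : Fin n → R) {P : R} {K : ℕ} (h : ∀ k, K ≤ k → ∀ i, S.d k i P = 0) :
    S.evolve X P = ∑ k ∈ Finset.range K, ∑ i, S.D^[k] (X i) * S.d k i P :=
  S.evolveFun_eq_sum X h

lemma order_D {P : R} {K : ℕ} (h : ∀ k, K ≤ k → ∀ i, S.d k i P = 0) :
    ∀ k, K + 1 ≤ k → ∀ i, S.d k i (S.D P) = 0 := by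
  rintro (_ | k) hk i
  · omega
  · rw [S.d_succ_D, h k (by omega), h (k + 1) (by omega), map_zero, add_zero]

/-- The terms `d k i P` in the commutation relations supply the products `D^(k+1) X^i * d k i P`,
which on the right come from the product rule. -/
lemma evolve_D (X : Fin n → R) (P : R) : S.evolve X (S.D P) = S.D (S.evolve X P) := by
  obtain ⟨K, hK⟩ := S.exists_order P
  -- Both sums run below `K + 1`, to leave room for the index shift; the added top term vanishes.
  have hK' : ∀ k, K + 1 ≤ k → ∀ i, S.d k i P = 0 := fun k hk => hK k (by omega)
  rw [S.evolve_eq_sum X (S.order_D hK), S.evolve_eq_sum X hK']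
  simp only [map_sum, Derivation.leibniz, smul_eq_mul, Finset.sum_add_distrib]
  rw [Finset.sum_range_succ' _ K, Finset.sum_range_succ' (fun k => ∑ i, S.D^[k] (X i) * _) K,
    Finset.sum_range_succ (fun k => ∑ i, S.d k i P * _) K]
  simp only [S.d_zero_D, S.d_succ_D, mul_add, Finset.sum_add_distrib, hK K le_rfl, zero_mul,
    Finset.sum_const_zero, add_zero, Function.iterate_succ_apply']
  have : ∑ k ∈ Finset.range K, ∑ i, S.D (S.D^[k] (X i)) * S.d k i P =
      ∑ k ∈ Finset.range K, ∑ i, S.d k i P * S.D (S.D^[k] (X i)) :=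
    Finset.sum_congr rfl fun k _ => Finset.sum_congr rfl fun i _ => mul_comm _ _
  rw [this]
  ring

lemma evolve_D_iterate (X : Fin n → R) (k : ℕ) (P : R) :
    S.evolve X (S.D^[k] P) = S.D^[k] (S.evolve X P) := by
  induction k with
  | zero => rfl
  | succ k ih => rw [Function.iterate_succ_apply', evolve_D, ih, Function.iterate_succ_apply']

/-- Evolutionary derivations are closed under commutators. -/
lemma evolve_comm (X Y : Fin n → R) (P : R) :
    S.evolve X (S.evolve Y P) - S.evolve Y (S.evolve X P) =
      S.evolve (fun i => S.evolve X (Y i) - S.evolve Y (X i)) P := by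
  obtain ⟨K, hK⟩ := S.exists_order P
  -- The first-order part survives in the commutator; the second-order part is symmetric in `X` and
  -- `Y` (`hsymm`) because partial derivatives commute.
  have key : ∀ X Y : Fin n → R, S.evolve X (S.evolve Y P) =
      ∑ k ∈ Finset.range K, ∑ i, S.D^[k] (S.evolve X (Y i)) * S.d k i P +
      ∑ k ∈ Finset.range K, ∑ i, ∑ l ∈ Finset.range K, ∑ j,
        S.D^[k] (Y i) * (S.D^[l] (X j) * S.d l j (S.d k i P)) := by
    intro X Y
    rw [S.evolve_eq_sum Y hK]
    simp only [map_sum, Derivation.leibniz, smul_eq_mul, Finset.sum_add_distrib,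
      S.evolve_D_iterate]
    rw [add_comm]
    congr 1
    · exact Finset.sum_congr rfl fun k _ => Finset.sum_congr rfl fun i _ => mul_comm _ _
    · refine Finset.sum_congr rfl fun k _ => Finset.sum_congr rfl fun i _ => ?_
      rw [S.evolve_eq_sum X (K := K) fun l hl j => by rw [S.d_comm, hK l hl, map_zero]]
      simp only [Finset.mul_sum]
  have hsymm : ∑ k ∈ Finset.range K, ∑ i, ∑ l ∈ Finset.range K, ∑ j,
        S.D^[k] (Y i) * (S.D^[l] (X j) * S.d l j (S.d k i P)) =
      ∑ k ∈ Finset.range K, ∑ i, ∑ l ∈ Finset.range K, ∑ j,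
        S.D^[k] (X i) * (S.D^[l] (Y j) * S.d l j (S.d k i P)) := by
    have h1 : ∀ k i, ∑ l ∈ Finset.range K, ∑ j,
        S.D^[k] (Y i) * (S.D^[l] (X j) * S.d l j (S.d k i P)) =
        ∑ a ∈ Finset.range K ×ˢ Finset.univ,
          S.D^[k] (Y i) * (S.D^[a.1] (X a.2) * S.d a.1 a.2 (S.d k i P)) :=
      fun k i => (Finset.sum_product' _ _ (fun l j =>
        S.D^[k] (Y i) * (S.D^[l] (X j) * S.d l j (S.d k i P)))).symm
    have h2 : ∀ k i, ∑ l ∈ Finset.range K, ∑ j,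
        S.D^[k] (X i) * (S.D^[l] (Y j) * S.d l j (S.d k i P)) =
        ∑ a ∈ Finset.range K ×ˢ Finset.univ,
          S.D^[k] (X i) * (S.D^[a.1] (Y a.2) * S.d a.1 a.2 (S.d k i P)) :=
      fun k i => (Finset.sum_product' _ _ (fun l j =>
        S.D^[k] (X i) * (S.D^[l] (Y j) * S.d l j (S.d k i P)))).symm
    simp only [h1, h2]
    rw [← Finset.sum_product' (Finset.range K) Finset.univ
        (fun k i => ∑ a ∈ Finset.range K ×ˢ Finset.univ,
          S.D^[k] (Y i) * (S.D^[a.1] (X a.2) * S.d a.1 a.2 (S.d k i P))),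
      ← Finset.sum_product' (Finset.range K) Finset.univ
        (fun k i => ∑ a ∈ Finset.range K ×ˢ Finset.univ,
          S.D^[k] (X i) * (S.D^[a.1] (Y a.2) * S.d a.1 a.2 (S.d k i P))), Finset.sum_comm]
    refine Finset.sum_congr rfl fun a _ => Finset.sum_congr rfl fun b _ => ?_
    rw [S.d_comm]
    ring
  rw [key X Y, key Y X, hsymm, S.evolve_eq_sum _ hK]
  simp only [iterate_map_sub, sub_mul, Finset.sum_sub_distrib]
  ring

/-- The variational derivative. -/
def varDeriv (P : R) (i : Fin n) : R := ∑ᶠ k : ℕ, (-1 : R) ^ k * S.D^[k] (S.d k i P)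

lemma varDeriv_eq_sum {P : R} {K : ℕ} (h : ∀ k, K ≤ k → ∀ i, S.d k i P = 0) (i : Fin n) :
    S.varDeriv P i = ∑ k ∈ Finset.range K, (-1 : R) ^ k * S.D^[k] (S.d k i P) := by
  refine finsum_eq_sum_of_support_subset _ fun k hk => ?_
  by_contra hk'
  refine hk ?_
  beta_reduce
  rw [h k (by simpa using hk') i, iterate_map_zero, mul_zero]

/-- The class of a density modulo total derivatives. -/
def integral : R →ₗ[ℝ] R ⧸ LinearMap.range (S.D : R →ₗ[ℝ] R) := Submodule.mkQ _

lemma integral_eq_zero_iff {P : R} : S.integral P = 0 ↔ ∃ T, S.D T = P := by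
  rw [integral, Submodule.mkQ_apply, Submodule.Quotient.mk_eq_zero]
  rfl

lemma integral_D (P : R) : S.integral (S.D P) = 0 := S.integral_eq_zero_iff.2 ⟨P, rfl⟩

lemma integral_mul_D (P Q : R) : S.integral (P * S.D Q) = -S.integral (S.D P * Q) := by
  have h := S.integral_D (P * Q)
  rw [Derivation.leibniz, map_add, smul_eq_mul, smul_eq_mul, mul_comm Q] at h
  exact eq_neg_of_add_eq_zero_left h

lemma integral_iterate_mul (k : ℕ) (P Q : R) :
    S.integral (S.D^[k] P * Q) = S.integral (P * ((-1) ^ k * S.D^[k] Q)) := by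
  induction k generalizing Q with
  | zero => simp
  | succ k ih =>
    rw [Function.iterate_succ_apply', ← neg_neg (S.integral (S.D _ * Q)), ← integral_mul_D, ih,
      ← map_neg, Function.iterate_succ_apply S.D k Q]
    congr 1
    ring

/-- The first variation formula: integration by parts moves every `D^k` off `X`, and what collects
on `X^i` is the variational derivative. -/
lemma integral_evolve (X : Fin n → R) (P : R) :
    S.integral (S.evolve X P) = S.integral (X ⬝ᵥ S.varDeriv P) := by
  obtain ⟨K, hK⟩ := S.exists_order P
  rw [S.evolve_eq_sum X hK, dotProduct]
  simp only [S.varDeriv_eq_sum hK, map_sum, S.integral_iterate_mul, Finset.mul_sum]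
  rw [Finset.sum_comm]

/-- Variational derivatives have a formally self-adjoint linearization. -/
lemma integral_evolve_varDeriv (X Y : Fin n → R) (P : R) :
    S.integral (∑ i, S.evolve X (S.varDeriv P i) * Y i) =
      S.integral (∑ i, S.evolve Y (S.varDeriv P i) * X i) := by
  -- Apply `X` to `Y(P) = Y · δP + D T`; the boundary term stays a total derivative since `X`
  -- commutes with `D`. Antisymmetrizing and using `evolve_comm` then leaves only the linearizations
  -- of `δP`.
  have key : ∀ X Y : Fin n → R, S.integral (S.evolve X (S.evolve Y P)) =
      S.integral (∑ i, S.evolve X (S.varDeriv P i) * Y i) +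
        S.integral (∑ i, S.evolve X (Y i) * S.varDeriv P i) := by
    intro X Y
    obtain ⟨T, hT⟩ := S.integral_eq_zero_iff.1 (show S.integral
      (S.evolve Y P - Y ⬝ᵥ S.varDeriv P) = 0 by rw [map_sub, integral_evolve, sub_self])
    rw [eq_add_of_sub_eq hT.symm, map_add, S.evolve_D, map_add, integral_D, zero_add, ← map_add,
      dotProduct, map_sum, ← Finset.sum_add_distrib]
    congr 1
    refine Finset.sum_congr rfl fun i _ => ?_
    rw [Derivation.leibniz, smul_eq_mul, smul_eq_mul]
    ring
  have h := congrArg S.integral (S.evolve_comm X Y P)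
  rw [map_sub, key X Y, key Y X, integral_evolve, dotProduct] at h
  simp only [sub_mul, Finset.sum_sub_distrib, map_sub] at h
  rw [← sub_eq_zero] at h ⊢
  rw [← h]
  abel

end JetAlgebra

end

/-! ### Skew-symmetry and the Jacobi identity for `D M⁻¹ K D M⁻ᵀ D`. -/

section

lemma dotProduct_mulVec_comm {n : ℕ} {R : Type*} [CommRing R] (K : Matrix (Fin n) (Fin n) R)
    (v w : Fin n → R) : v ⬝ᵥ (K *ᵥ w) = (Kᵀ *ᵥ v) ⬝ᵥ w := by
  rw [Matrix.dotProduct_mulVec, Matrix.mulVec_transpose]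

section Derivation

variable {n : ℕ} {R : Type*} [CommRing R] [Algebra ℝ R] (δ : Derivation ℝ R R)

lemma derivation_dotProduct (v w : Fin n → R) :
    δ (v ⬝ᵥ w) = (δ ∘ v) ⬝ᵥ w + v ⬝ᵥ (δ ∘ w) := by
  simp only [dotProduct, map_sum, Derivation.leibniz, smul_eq_mul, Function.comp_apply,
    ← Finset.sum_add_distrib]
  exact Finset.sum_congr rfl fun i _ => by ring

lemma derivation_mulVec (M : Matrix (Fin n) (Fin n) R) (v : Fin n → R) :
    δ ∘ (M *ᵥ v) = M.map δ *ᵥ v + M *ᵥ (δ ∘ v) :=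
  funext fun i => derivation_dotProduct δ (M i) v

/-- The matrix `∑ ψ^γ_{ik} X^k`. -/
def linMat (psi : Fin n → Matrix (Fin n) (Fin n) ℝ) (X : Fin n → R) : Matrix (Fin n) (Fin n) R :=
  Matrix.of fun γ i => ∑ k, psi γ i k • X k

/-- The matrix `∑ ψ^γ_{ik} u^k + ω^γ_i` with entries in an algebra. -/
def affMat (psi : Fin n → Matrix (Fin n) (Fin n) ℝ) (omega : Matrix (Fin n) (Fin n) ℝ)
    (u : Fin n → R) : Matrix (Fin n) (Fin n) R :=
  linMat psi u + omega.map (algebraMap ℝ R)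

variable (psi : Fin n → Matrix (Fin n) (Fin n) ℝ) (omega : Matrix (Fin n) (Fin n) ℝ)

lemma map_linMat (X : Fin n → R) : (linMat psi X).map δ = linMat psi (δ ∘ X) := by
  ext γ i
  simp [linMat]

lemma map_affMat (u : Fin n → R) : (affMat psi omega u).map δ = linMat psi (δ ∘ u) := by
  rw [← map_linMat]
  ext γ i
  simp [affMat]

lemma map_constMat (M : Matrix (Fin n) (Fin n) ℝ) : (M.map (algebraMap ℝ R)).map δ = 0 := by
  ext γ i
  simp

variable {psi}

lemma linMat_mulVec_skew (hpsi : ∀ γ i k, psi γ k i = -psi γ i k) (X Y : Fin n → R) :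
    linMat psi X *ᵥ Y = -(linMat psi Y *ᵥ X) := by
  ext γ
  simp only [linMat, Matrix.mulVec, dotProduct, Matrix.of_apply, Pi.neg_apply, Finset.sum_mul]
  rw [Finset.sum_comm, ← Finset.sum_neg_distrib]
  refine Finset.sum_congr rfl fun i _ => ?_
  rw [← Finset.sum_neg_distrib]
  refine Finset.sum_congr rfl fun k _ => ?_
  rw [hpsi γ i k, neg_smul, neg_mul, smul_mul_assoc, smul_mul_assoc, mul_comm]

end Derivation

namespace JetAlgebra

variable {n : ℕ} {R : Type*} [CommRing R] [Algebra ℝ R] (S : JetAlgebra n R)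

lemma integral_dotProduct_D (v w : Fin n → R) :
    S.integral (v ⬝ᵥ (S.D ∘ w)) = -S.integral ((S.D ∘ v) ⬝ᵥ w) := by
  simp only [dotProduct, map_sum, Function.comp_apply, integral_mul_D, Finset.sum_neg_distrib]

lemma evolve_D_comp (X a : Fin n → R) : S.evolve X ∘ (S.D ∘ a) = S.D ∘ (S.evolve X ∘ a) :=
  funext fun i => S.evolve_D X (a i)

/-- `s` and `b` are the intermediate stages `s = M⁻ᵀ D a`, `b = M⁻¹ K D s` in the evaluation of the
operator `D M⁻¹ K D M⁻ᵀ D` at `a`. -/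
structure IsFactorization (M K : Matrix (Fin n) (Fin n) R) (a s b : Fin n → R) : Prop where
  left : Mᵀ *ᵥ s = S.D ∘ a
  right : M *ᵥ b = K *ᵥ (S.D ∘ s)

variable {S}

lemma integral_const_mulVec_D (K : Matrix (Fin n) (Fin n) ℝ) (v w : Fin n → R) :
    S.integral (v ⬝ᵥ (K.map (algebraMap ℝ R) *ᵥ (S.D ∘ w))) =
      -S.integral (((Kᵀ.map (algebraMap ℝ R)) *ᵥ (S.D ∘ v)) ⬝ᵥ w) := by
  rw [dotProduct_mulVec_comm, integral_dotProduct_D, derivation_mulVec, ← Matrix.transpose_map,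
    map_constMat, Matrix.zero_mulVec, zero_add]

variable {K : Matrix (Fin n) (Fin n) ℝ} {M : Matrix (Fin n) (Fin n) R} {a b a₁ a₂ b₁ b₂ : Fin n → R}

/-- Moving the outer `D` and `M⁻¹` to the other side turns the bracket into `-∫ a₁ · K D b₁`, and `K
D` is skew-adjoint for a constant symmetric `K`. -/
lemma IsFactorization.skew (hK : Kᵀ = K)
    (ha : S.IsFactorization M (K.map (algebraMap ℝ R)) a a₁ a₂)
    (hb : S.IsFactorization M (K.map (algebraMap ℝ R)) b b₁ b₂) :
    S.integral (a ⬝ᵥ (S.D ∘ b₂) + b ⬝ᵥ (S.D ∘ a₂)) = 0 := by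
  have key : ∀ {a b a₁ a₂ b₁ b₂ : Fin n → R},
      S.IsFactorization M (K.map (algebraMap ℝ R)) a a₁ a₂ →
      S.IsFactorization M (K.map (algebraMap ℝ R)) b b₁ b₂ →
      S.integral (a ⬝ᵥ (S.D ∘ b₂)) =
        -S.integral (a₁ ⬝ᵥ (K.map (algebraMap ℝ R) *ᵥ (S.D ∘ b₁))) := by
    intro a b a₁ a₂ b₁ b₂ ha hb
    rw [integral_dotProduct_D, ← ha.left, ← dotProduct_mulVec_comm, hb.right]
  rw [map_add, key ha hb, key hb ha, integral_const_mulVec_D, hK, dotProduct_comm, neg_neg,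
    add_neg_cancel]

variable {psi : Fin n → Matrix (Fin n) (Fin n) ℝ} {omega : Matrix (Fin n) (Fin n) ℝ}
  {u : Fin n → R}

/-- The variation of the bracket `∫ a · D b₂` along an evolutionary vector field. -/
lemma IsFactorization.integral_evolve (hK : Kᵀ = K) {X : Fin n → R} (hX : S.evolve X ∘ u = X)
    (ha : S.IsFactorization (affMat psi omega u) (K.map (algebraMap ℝ R)) a a₁ a₂)
    (hb : S.IsFactorization (affMat psi omega u) (K.map (algebraMap ℝ R)) b b₁ b₂) :
    S.integral (S.evolve X (a ⬝ᵥ (S.D ∘ b₂))) =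
      S.integral ((S.evolve X ∘ a) ⬝ᵥ (S.D ∘ b₂)) - S.integral ((S.evolve X ∘ b) ⬝ᵥ (S.D ∘ a₂)) +
      S.integral (a₁ ⬝ᵥ (linMat psi X *ᵥ b₂)) - S.integral (b₁ ⬝ᵥ (linMat psi X *ᵥ a₂)) := by
  set δ := S.evolve X
  set M := affMat psi omega u
  set K' : Matrix (Fin n) (Fin n) R := K.map (algebraMap ℝ R)
  -- `M` is affine in `u`, so its variation is `ψ(X)`. Varying the defining equations of the stages
  -- avoids differentiating inverse matrices.
  have hM : M.map δ = linMat psi X := by rw [map_affMat, hX]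
  have h1 : M *ᵥ (δ ∘ b₂) = K' *ᵥ (S.D ∘ (δ ∘ b₁)) - linMat psi X *ᵥ b₂ := by
    have h := congrArg (δ ∘ ·) hb.right
    simp only [derivation_mulVec] at h
    rw [map_constMat, Matrix.zero_mulVec, zero_add, hM, S.evolve_D_comp] at h
    rw [← h, add_sub_cancel_left]
  have h2 : Mᵀ *ᵥ (δ ∘ b₁) = S.D ∘ (δ ∘ b) - (linMat psi X)ᵀ *ᵥ b₁ := by
    have h := congrArg (δ ∘ ·) hb.left
    simp only [derivation_mulVec] at h
    rw [Matrix.transpose_map, hM, S.evolve_D_comp] at h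
    rw [← h, add_sub_cancel_left]
  -- Skew-adjointness moves the variation from `b₂` back to `b`; each of the two factors `M` and
  -- `Mᵀ` that depend on `u` contributes one term with `ψ(X)`.
  have h3 : S.integral ((S.D ∘ a) ⬝ᵥ (δ ∘ b₂)) = S.integral ((S.D ∘ a₂) ⬝ᵥ (δ ∘ b)) +
      S.integral (a₂ ⬝ᵥ ((linMat psi X)ᵀ *ᵥ b₁)) - S.integral (a₁ ⬝ᵥ (linMat psi X *ᵥ b₂)) := by
    rw [← ha.left, ← dotProduct_mulVec_comm, h1, dotProduct_sub, map_sub,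
      integral_const_mulVec_D, hK, ← ha.right, ← M.transpose_transpose, ← dotProduct_mulVec_comm,
      h2, dotProduct_sub, map_sub, integral_dotProduct_D]
    abel
  have h4 : a₂ ⬝ᵥ ((linMat psi X)ᵀ *ᵥ b₁) = b₁ ⬝ᵥ (linMat psi X *ᵥ a₂) := by
    rw [dotProduct_mulVec_comm, Matrix.transpose_transpose, dotProduct_comm]
  rw [derivation_dotProduct, map_add, S.evolve_D_comp, S.integral_dotProduct_D a, h3, h4,
    dotProduct_comm (S.D ∘ a₂)]
  abel

variable (S) in
lemma integral_evolve_varDeriv_dotProduct (X Y : Fin n → R) (P : R) :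
    S.integral ((S.evolve X ∘ S.varDeriv P) ⬝ᵥ Y) =
      S.integral ((S.evolve Y ∘ S.varDeriv P) ⬝ᵥ X) :=
  S.integral_evolve_varDeriv X Y P

/-- The Jacobi identity for `D M⁻¹ K D M⁻ᵀ D` with `M = ψ_{ik} u^k + ω_i` and `K = φ⁻¹`. -/
theorem jacobi {φ : Matrix (Fin n) (Fin n) ℝ} (hK : Kᵀ = K) (hφ : φ * K = 1)
    (hpsi : ∀ γ i k, psi γ k i = -psi γ i k) (hu : ∀ X, S.evolve X ∘ u = X)
    (hcyc : ∀ x y z : Fin n → R,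
      (φ.map (algebraMap ℝ R) *ᵥ (affMat psi omega u *ᵥ x)) ⬝ᵥ (linMat psi z *ᵥ y) +
      (φ.map (algebraMap ℝ R) *ᵥ (affMat psi omega u *ᵥ y)) ⬝ᵥ (linMat psi x *ᵥ z) +
      (φ.map (algebraMap ℝ R) *ᵥ (affMat psi omega u *ᵥ z)) ⬝ᵥ (linMat psi y *ᵥ x) = 0)
    {P Q T : R} {p₁ p₂ q₁ q₂ t₁ t₂ : Fin n → R}
    (hP : S.IsFactorization (affMat psi omega u) (K.map (algebraMap ℝ R)) (S.varDeriv P) p₁ p₂)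
    (hQ : S.IsFactorization (affMat psi omega u) (K.map (algebraMap ℝ R)) (S.varDeriv Q) q₁ q₂)
    (hT : S.IsFactorization (affMat psi omega u) (K.map (algebraMap ℝ R)) (S.varDeriv T) t₁ t₂) :
    S.integral (S.varDeriv (S.varDeriv P ⬝ᵥ (S.D ∘ q₂)) ⬝ᵥ (S.D ∘ t₂) +
      S.varDeriv (S.varDeriv Q ⬝ᵥ (S.D ∘ t₂)) ⬝ᵥ (S.D ∘ p₂) +
      S.varDeriv (S.varDeriv T ⬝ᵥ (S.D ∘ p₂)) ⬝ᵥ (S.D ∘ q₂)) = 0 := by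
  have hφ' : φ.map (algebraMap ℝ R) * K.map (algebraMap ℝ R) = 1 := by
    rw [← Matrix.map_mul, hφ, Matrix.map_one _ (map_zero _) (map_one _)]
  -- The bracket of `{a, b}` with `c` is the variation of `{a, b}` along the evolutionary field `D
  -- c`.
  have step : ∀ {a b a₁ a₂ b₁ b₂ : Fin n → R} (c : Fin n → R),
      S.IsFactorization (affMat psi omega u) (K.map (algebraMap ℝ R)) a a₁ a₂ →
      S.IsFactorization (affMat psi omega u) (K.map (algebraMap ℝ R)) b b₁ b₂ →
      S.integral (S.varDeriv (a ⬝ᵥ (S.D ∘ b₂)) ⬝ᵥ (S.D ∘ c)) =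
      S.integral ((S.evolve (S.D ∘ c) ∘ a) ⬝ᵥ (S.D ∘ b₂)) -
        S.integral ((S.evolve (S.D ∘ c) ∘ b) ⬝ᵥ (S.D ∘ a₂)) +
        S.integral (a₁ ⬝ᵥ (linMat psi (S.D ∘ c) *ᵥ b₂)) -
        S.integral (b₁ ⬝ᵥ (linMat psi (S.D ∘ c) *ᵥ a₂)) := fun c ha hb => by
    rw [dotProduct_comm, ← S.integral_evolve]
    exact ha.integral_evolve hK (hu (S.D ∘ c)) hb
  -- Integrate `D (ψ(y) x) = ψ(D y) x - ψ(D x) y` against `a₁`, and replace `D a₁` by `φ M a₂` using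
  -- the second stage equation.
  have parts : ∀ {a a₁ a₂ : Fin n → R} (x y : Fin n → R),
      S.IsFactorization (affMat psi omega u) (K.map (algebraMap ℝ R)) a a₁ a₂ →
      S.integral (a₁ ⬝ᵥ (linMat psi (S.D ∘ y) *ᵥ x)) =
      S.integral (a₁ ⬝ᵥ (linMat psi (S.D ∘ x) *ᵥ y)) -
      S.integral ((φ.map (algebraMap ℝ R) *ᵥ (affMat psi omega u *ᵥ a₂)) ⬝ᵥ
        (linMat psi y *ᵥ x)) := fun {a a₁ a₂} x y ha => by
    have h : S.D ∘ (linMat psi y *ᵥ x) =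
        linMat psi (S.D ∘ y) *ᵥ x - linMat psi (S.D ∘ x) *ᵥ y := by
      rw [derivation_mulVec, map_linMat, linMat_mulVec_skew hpsi y (S.D ∘ x),
        sub_eq_add_neg]
    have h' := S.integral_dotProduct_D a₁ (linMat psi y *ᵥ x)
    rw [h, dotProduct_sub, map_sub] at h'
    rw [ha.right, Matrix.mulVec_mulVec, hφ', Matrix.one_mulVec, sub_eq_iff_eq_add.1 h']
    abel
  have hc := congrArg S.integral (hcyc p₂ q₂ t₂)
  rw [map_add, map_add, map_zero] at hc
  -- Self-adjointness cancels the six second-variation terms in pairs. After `parts`, the terms with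
  -- `ψ(D ·)` cancel in pairs as well, and the leftover is the cyclic sum `hc`.
  rw [map_add, map_add, step t₂ hP hQ, step p₂ hQ hT, step q₂ hT hP,
    parts q₂ t₂ hP, parts t₂ p₂ hQ, parts p₂ q₂ hT,
    S.integral_evolve_varDeriv_dotProduct (S.D ∘ t₂) (S.D ∘ q₂),
    S.integral_evolve_varDeriv_dotProduct (S.D ∘ p₂) (S.D ∘ t₂),
    S.integral_evolve_varDeriv_dotProduct (S.D ∘ q₂) (S.D ∘ p₂), ← neg_eq_zero.2 hc]
  abel

end JetAlgebra

end

/-! ### Differential functions as smooth functions on finite-dimensional jet spaces. -/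

section

section DiffFun

variable {n : ℕ}

/-- The jets whose coordinate of order `m` lies in `U`. -/
abbrev cylinder (m : ℕ) (U : Set (Fin n → ℝ)) : Set (Jet n) := {q | q.2 m ∈ U}

lemma jetTrunc_surjective (k : ℕ) : Function.Surjective (jetTrunc (n := n) k) := fun x =>
  ⟨(x.1, fun j => if h : j < k then x.2 ⟨j, h⟩ else 0), by
    refine Prod.ext rfl (funext fun j => ?_)
    simp [jetTrunc]⟩

lemma image_jetTrunc_cylinder {m k : ℕ} (hk : m < k) (U : Set (Fin n → ℝ)) :
    jetTrunc k '' cylinder m U = {x | x.2 ⟨m, hk⟩ ∈ U} := by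
  ext x
  obtain ⟨q, rfl⟩ := jetTrunc_surjective k x
  constructor
  · rintro ⟨r, hr, hrq⟩
    rw [← hrq]
    exact hr
  · intro h
    exact ⟨q, h, rfl⟩

/-- With `m < k` the truncation still sees the constrained coordinate, so representatives live on
open sets and ordinary Fréchet derivatives apply. -/
lemma isOpen_image_jetTrunc {m k : ℕ} (hk : m < k) {U : Set (Fin n → ℝ)} (hU : IsOpen U) :
    IsOpen (jetTrunc k '' cylinder m U) := by
  rw [image_jetTrunc_cylinder hk]
  exact hU.preimage (by fun_prop)

/-- Forgetting the highest jet coordinates. -/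
def jetRestrict {k l : ℕ} (h : k ≤ l) :
    (ℝ × (Fin l → Fin n → ℝ)) →L[ℝ] (ℝ × (Fin k → Fin n → ℝ)) :=
  (ContinuousLinearMap.fst ℝ _ _).prod
    (ContinuousLinearMap.pi fun j =>
      (ContinuousLinearMap.proj (Fin.castLE h j)).comp (ContinuousLinearMap.snd ℝ _ _))

lemma jetRestrict_jetTrunc {k l : ℕ} (h : k ≤ l) (q : Jet n) :
    jetRestrict h (jetTrunc l q) = jetTrunc k q := rfl

/-- The differential function `P` is represented by the smooth function `p` of jets of order less
than `k`. -/
structure IsRep (m : ℕ) (U : Set (Fin n → ℝ)) (k : ℕ) (p : ℝ × (Fin k → Fin n → ℝ) → ℝ)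
    (P : Jet n → ℝ) : Prop where
  lt : m < k
  contDiffOn : ContDiffOn ℝ (⊤ : ℕ∞) p (jetTrunc k '' cylinder m U)
  eq : ∀ q ∈ cylinder m U, P q = p (jetTrunc k q)

variable {m : ℕ} {U : Set (Fin n → ℝ)} {P Q : Jet n → ℝ}

lemma IsRep.isDiffFun {k : ℕ} {p : ℝ × (Fin k → Fin n → ℝ) → ℝ} (h : IsRep m U k p P) :
    IsDiffFun (cylinder m U) P :=
  ⟨k, p, h.contDiffOn, h.eq⟩

lemma IsDiffFun.exists_isRep (h : IsDiffFun (cylinder m U) P) :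
    ∃ K, ∀ k, K ≤ k → ∃ p, IsRep m U k p P := by
  obtain ⟨k, p, hp, hP⟩ := h
  refine ⟨max k (m + 1), fun l hl => ?_⟩
  have hkl : k ≤ l := le_trans (le_max_left _ _) hl
  refine ⟨p ∘ jetRestrict hkl, by have := le_max_right k (m + 1); omega,
    hp.comp (jetRestrict hkl).contDiff.contDiffOn ?_, hP⟩
  rintro _ ⟨q, hq, rfl⟩
  exact ⟨q, hq, rfl⟩

lemma IsDiffFun.exists_isRep₂ (hP : IsDiffFun (cylinder m U) P) (hQ : IsDiffFun (cylinder m U) Q) :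
    ∃ k p r, IsRep m U k p P ∧ IsRep m U k r Q := by
  obtain ⟨K, hK⟩ := hP.exists_isRep
  obtain ⟨L, hL⟩ := hQ.exists_isRep
  obtain ⟨p, hp⟩ := hK _ (le_max_left K L)
  obtain ⟨r, hr⟩ := hL _ (le_max_right K L)
  exact ⟨_, p, r, hp, hr⟩

section IsRep

variable {k : ℕ} {p r : ℝ × (Fin k → Fin n → ℝ) → ℝ}

lemma IsRep.add (hP : IsRep m U k p P) (hQ : IsRep m U k r Q) :
    IsRep m U k (fun x => p x + r x) (fun q => P q + Q q) :=
  ⟨hP.lt, hP.contDiffOn.add hQ.contDiffOn, fun q hq => by rw [hP.eq q hq, hQ.eq q hq]⟩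

lemma IsRep.mul (hP : IsRep m U k p P) (hQ : IsRep m U k r Q) :
    IsRep m U k (fun x => p x * r x) (fun q => P q * Q q) :=
  ⟨hP.lt, hP.contDiffOn.mul hQ.contDiffOn, fun q hq => by rw [hP.eq q hq, hQ.eq q hq]⟩

lemma isRep_const (h : m < k) (c : ℝ) : IsRep m U k (fun _ => c) (fun _ => c) :=
  ⟨h, contDiffOn_const, fun _ _ => rfl⟩

lemma IsRep.inv (hP : IsRep m U k p P) (h0 : ∀ q ∈ cylinder m U, P q ≠ 0) :
    IsRep m U k (fun x => (p x)⁻¹) (fun q => (P q)⁻¹) :=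
  ⟨hP.lt, hP.contDiffOn.inv (by rintro _ ⟨q, hq, rfl⟩; rw [← hP.eq q hq]; exact h0 q hq),
    fun q hq => by rw [hP.eq q hq]⟩

lemma IsRep.congr (hP : IsRep m U k p P) (h : ∀ q ∈ cylinder m U, Q q = P q) : IsRep m U k p Q :=
  ⟨hP.lt, hP.contDiffOn, fun q hq => (h q hq).trans (hP.eq q hq)⟩

lemma isRep_clm (h : m < k) (L : (ℝ × (Fin k → Fin n → ℝ)) →L[ℝ] ℝ) :
    IsRep m U k L (fun q => L (jetTrunc k q)) :=
  ⟨h, L.contDiff.contDiffOn, fun _ _ => rfl⟩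

lemma IsRep.contDiffAt (hU : IsOpen U) (hP : IsRep m U k p P) {q : Jet n}
    (hq : q ∈ cylinder m U) : ContDiffAt ℝ (⊤ : ℕ∞) p (jetTrunc k q) :=
  hP.contDiffOn.contDiffAt ((isOpen_image_jetTrunc hP.lt hU).mem_nhds ⟨q, hq, rfl⟩)

lemma IsRep.differentiableAt (hU : IsOpen U) (hP : IsRep m U k p P) {q : Jet n}
    (hq : q ∈ cylinder m U) : DifferentiableAt ℝ p (jetTrunc k q) :=
  (hP.contDiffAt hU hq).differentiableAt (by simp)

lemma IsRep.contDiffOn_fderiv (hU : IsOpen U) (hP : IsRep m U k p P) :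
    ContDiffOn ℝ (⊤ : ℕ∞) (fderiv ℝ p) (jetTrunc k '' cylinder m U) :=
  hP.contDiffOn.fderiv_of_isOpen (isOpen_image_jetTrunc hP.lt hU) (by simp)

lemma IsRep.differentiableAt_fderiv (hU : IsOpen U) (hP : IsRep m U k p P) {q : Jet n}
    (hq : q ∈ cylinder m U) : DifferentiableAt ℝ (fderiv ℝ p) (jetTrunc k q) :=
  ((hP.contDiffOn_fderiv hU).contDiffAt
    ((isOpen_image_jetTrunc hP.lt hU).mem_nhds ⟨q, hq, rfl⟩)).differentiableAt (by simp)

lemma IsRep.fderiv_fderiv_symm (hU : IsOpen U) (hP : IsRep m U k p P) {q : Jet n}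
    (hq : q ∈ cylinder m U) (v w : ℝ × (Fin k → Fin n → ℝ)) :
    fderiv ℝ (fderiv ℝ p) (jetTrunc k q) v w = fderiv ℝ (fderiv ℝ p) (jetTrunc k q) w v :=
  (hP.contDiffAt hU hq).isSymmSndFDerivAt (by
    rw [minSmoothness_of_isRCLikeNormedField]
    exact WithTop.coe_le_coe.2 (le_top : (2 : ℕ∞) ≤ ⊤)) v w

lemma eventually_mem_cylinder (hU : IsOpen U) {q : Jet n} (hq : q ∈ cylinder m U) (w : Jet n) :
    ∀ᶠ s : ℝ in nhds 0, q + s • w ∈ cylinder m U := by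
  have hc : Continuous fun s : ℝ => q.2 m + s • w.2 m := by fun_prop
  refine hc.continuousAt.eventually_mem (hU.mem_nhds ?_)
  simpa using hq

/-- The link between the one-variable `deriv` defining `partialX` and `partialU` and the Fréchet
derivative of a representative: both operators differentiate along lines. -/
lemma IsRep.hasDerivAt_line (hU : IsOpen U) (hP : IsRep m U k p P) {q : Jet n}
    (hq : q ∈ cylinder m U) (w : Jet n) :
    HasDerivAt (fun s : ℝ => P (q + s • w)) (fderiv ℝ p (jetTrunc k q) (jetTrunc k w)) 0 := by
  have hline : HasDerivAt (fun s : ℝ => jetTrunc k q + s • jetTrunc k w) (jetTrunc k w) 0 := by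
    simpa using ((hasDerivAt_id (0 : ℝ)).smul_const (jetTrunc k w)).const_add (jetTrunc k q)
  have hp : HasFDerivAt p (fderiv ℝ p (jetTrunc k q)) (jetTrunc k q + (0 : ℝ) • jetTrunc k w) := by
    simpa using (hP.differentiableAt hU hq).hasFDerivAt
  refine (hp.comp_hasDerivAt 0 hline).congr_of_eventuallyEq ?_
  filter_upwards [eventually_mem_cylinder hU hq w] with s hs
  rw [hP.eq _ hs]
  rfl

/-- The coordinate direction of `u^i_l`. -/
def jetBasis (l : ℕ) (i : Fin n) : Jet n := (0, Pi.single l (Pi.single i 1))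

/-- The direction of the total derivative. -/
def jetShift (q : Jet n) : Jet n := (1, fun j => q.2 (j + 1))

lemma IsRep.partialX_eq (hU : IsOpen U) (hP : IsRep m U k p P) {q : Jet n}
    (hq : q ∈ cylinder m U) :
    partialX P q = fderiv ℝ p (jetTrunc k q) (jetTrunc k (1, 0)) := by
  have h := hP.hasDerivAt_line hU hq (1, 0)
  rw [← sub_self q.1] at h
  rw [partialX, ← (h.comp_sub_const q.1 q.1).deriv]
  congr 1
  ext s
  congr 1
  ext <;> simp

lemma IsRep.partialU_eq (hU : IsOpen U) (hP : IsRep m U k p P) {q : Jet n}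
    (hq : q ∈ cylinder m U) (l : ℕ) (i : Fin n) :
    partialU l i P q = fderiv ℝ p (jetTrunc k q) (jetTrunc k (jetBasis l i)) := by
  have h := hP.hasDerivAt_line hU hq (jetBasis l i)
  rw [← sub_self (q.2 l i)] at h
  rw [partialU, ← (h.comp_sub_const (q.2 l i) (q.2 l i)).deriv]
  congr 1
  ext s
  congr 1
  refine Prod.ext (by simp [jetBasis]) (funext fun j => funext fun a => ?_)
  by_cases hj : j = l
  · subst hj
    by_cases ha : a = i
    · subst ha
      simp [jetBasis]
    · simp [jetBasis, ha]
  · simp [jetBasis, hj]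

/-- Serves to collapse the sum defining `totalD` into a single directional derivative. -/
lemma jetTrunc_jetShift (k : ℕ) (q : Jet n) :
    jetTrunc k (jetShift q) = jetTrunc k (1, 0) +
      ∑ l ∈ Finset.range k, ∑ i, q.2 (l + 1) i • jetTrunc k (jetBasis l i) := by
  refine Prod.ext ?_ (funext fun j => funext fun a => ?_)
  · simp [jetTrunc, jetShift, jetBasis, Prod.fst_sum]
  · simp only [jetTrunc, jetShift, jetBasis, Prod.snd_add, Prod.snd_sum, Prod.smul_snd,
      Pi.add_apply, Finset.sum_apply, Pi.smul_apply, Pi.zero_apply, zero_add, smul_eq_mul]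
    rw [Finset.sum_eq_single (j : ℕ), Finset.sum_eq_single a]
    · simp
    · intro b _ hb
      simp [hb.symm]
    · simp
    · intro b _ hb
      simp [hb.symm]
    · intro h
      exact absurd (Finset.mem_range.2 j.2) h

lemma jetTrunc_jetBasis_of_le {k l : ℕ} (h : k ≤ l) (i : Fin n) :
    jetTrunc k (jetBasis l i) = 0 := by
  refine Prod.ext rfl (funext fun j => ?_)
  have : (j : ℕ) ≠ l := by omega
  simp [jetTrunc, jetBasis, this]

lemma IsRep.totalD_eq (hU : IsOpen U) (hP : IsRep m U k p P) {q : Jet n}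
    (hq : q ∈ cylinder m U) :
    totalD P q = fderiv ℝ p (jetTrunc k q) (jetTrunc k (jetShift q)) := by
  rw [totalD, hP.partialX_eq hU hq, finsum_eq_sum_of_support_subset (s := Finset.range k),
    jetTrunc_jetShift]
  · simp only [map_add, map_sum, map_smul, smul_eq_mul, hP.partialU_eq hU hq]
  · intro l hl
    by_contra hl'
    refine hl (Finset.sum_eq_zero fun i _ => ?_)
    rw [hP.partialU_eq hU hq, jetTrunc_jetBasis_of_le (by simpa using hl'), map_zero, mul_zero]

lemma IsRep.partialU (hU : IsOpen U) (hP : IsRep m U k p P) (l : ℕ) (i : Fin n) :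
    IsRep m U k (fun x => fderiv ℝ p x (jetTrunc k (jetBasis l i))) (partialU l i P) :=
  ⟨hP.lt, (hP.contDiffOn_fderiv hU).clm_apply contDiffOn_const,
    fun _ hq => hP.partialU_eq hU hq l i⟩

/-- The shift of truncated jets, linear part. -/
def truncShift (k : ℕ) : (ℝ × (Fin (k + 1) → Fin n → ℝ)) →L[ℝ] (ℝ × (Fin k → Fin n → ℝ)) :=
  (0 : _ →L[ℝ] ℝ).prod (ContinuousLinearMap.pi fun j =>
      (ContinuousLinearMap.proj j.succ).comp (ContinuousLinearMap.snd ℝ _ _))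

lemma jetTrunc_jetShift_eq (k : ℕ) (q : Jet n) :
    jetTrunc k (jetShift q) = jetTrunc k (1, 0) + truncShift k (jetTrunc (k + 1) q) :=
  Prod.ext (by simp [jetTrunc, jetShift, truncShift])
    (funext fun j => by simp [jetTrunc, jetShift, truncShift])

lemma IsRep.totalD (hU : IsOpen U) (hP : IsRep m U k p P) :
    IsRep m U (k + 1)
      (fun x => fderiv ℝ p (jetRestrict k.le_succ x) (jetTrunc k (1, 0) + truncShift k x))
      (totalD P) := by
  refine ⟨by have := hP.lt; omega, ContDiffOn.clm_apply ?_
    (contDiff_const.add (truncShift k).contDiff).contDiffOn, fun q hq => ?_⟩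
  · refine (hP.contDiffOn_fderiv hU).comp (jetRestrict k.le_succ).contDiff.contDiffOn ?_
    rintro _ ⟨q, hq, rfl⟩
    exact ⟨q, hq, rfl⟩
  · rw [jetRestrict_jetTrunc, ← jetTrunc_jetShift_eq, hP.totalD_eq hU hq]

lemma IsRep.partialU_comm (hU : IsOpen U) (hP : IsRep m U k p P) {q : Jet n}
    (hq : q ∈ cylinder m U) (l : ℕ) (i : Fin n) (l' : ℕ) (i' : Fin n) :
    WDVV.partialU l i (WDVV.partialU l' i' P) q = WDVV.partialU l' i' (WDVV.partialU l i P) q := by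
  rw [(hP.partialU hU l' i').partialU_eq hU hq, (hP.partialU hU l i).partialU_eq hU hq]
  have h := hP.differentiableAt_fderiv hU hq
  rw [fderiv_clm_apply h (differentiableAt_const _), fderiv_clm_apply h (differentiableAt_const _)]
  simp [hP.fderiv_fderiv_symm hU hq (jetTrunc k (jetBasis l i))]

/-- The second-derivative terms agree by symmetry. The correction arises because the direction of
`totalD` itself depends linearly on the jet; for `l = 0` it is zero, and for `l + 1` it is the
partial derivative of order `l`. -/
lemma IsRep.partialU_totalD (hU : IsOpen U) (hP : IsRep m U k p P) {q : Jet n}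
    (hq : q ∈ cylinder m U) (l : ℕ) (i : Fin n) :
    WDVV.partialU l i (WDVV.totalD P) q = WDVV.totalD (WDVV.partialU l i P) q +
      fderiv ℝ p (jetTrunc k q) (truncShift k (jetTrunc (k + 1) (jetBasis l i))) := by
  rw [(hP.totalD hU).partialU_eq hU hq, (hP.partialU hU l i).totalD_eq hU hq]
  have h := hP.differentiableAt_fderiv hU hq
  have h' : HasFDerivAt (fun x => fderiv ℝ p (jetRestrict k.le_succ x))
      ((fderiv ℝ (fderiv ℝ p) (jetTrunc k q)).comp (jetRestrict k.le_succ)) (jetTrunc (k + 1) q) :=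
    HasFDerivAt.comp (g := fderiv ℝ p) (jetTrunc (k + 1) q) h.hasFDerivAt
      (jetRestrict k.le_succ).hasFDerivAt
  rw [(h'.clm_apply ((truncShift k).hasFDerivAt.const_add _)).fderiv,
    fderiv_clm_apply h (differentiableAt_const _)]
  simp only [_root_.add_apply, ContinuousLinearMap.comp_apply,
    ContinuousLinearMap.flip_apply, jetRestrict_jetTrunc, ← jetTrunc_jetShift_eq,
    fderiv_const_apply, map_zero, _root_.zero_apply, zero_add]
  rw [add_comm, hP.fderiv_fderiv_symm hU hq]

end IsRep

lemma truncShift_jetBasis_zero (k : ℕ) (i : Fin n) :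
    truncShift k (jetTrunc (k + 1) (jetBasis 0 i)) = 0 :=
  Prod.ext (by simp [truncShift]) (funext fun j => by simp [truncShift, jetTrunc, jetBasis])

lemma truncShift_jetBasis_succ (k l : ℕ) (i : Fin n) :
    truncShift k (jetTrunc (k + 1) (jetBasis (l + 1) i)) = jetTrunc k (jetBasis l i) :=
  Prod.ext (by simp [truncShift, jetTrunc, jetBasis])
    (funext fun j => by simp [truncShift, jetTrunc, jetBasis, Pi.single_apply])

end DiffFun

end

/-! ### The algebra of differential functions on a cylinder, as a `JetAlgebra`. -/

section

variable {n : ℕ} {m : ℕ} {U : Set (Fin n → ℝ)} {P Q : Jet n → ℝ}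

lemma IsDiffFun.add (hP : IsDiffFun (cylinder m U) P) (hQ : IsDiffFun (cylinder m U) Q) :
    IsDiffFun (cylinder m U) (fun q => P q + Q q) := by
  obtain ⟨k, p, r, hp, hr⟩ := hP.exists_isRep₂ hQ
  exact (hp.add hr).isDiffFun

lemma IsDiffFun.mul (hP : IsDiffFun (cylinder m U) P) (hQ : IsDiffFun (cylinder m U) Q) :
    IsDiffFun (cylinder m U) (fun q => P q * Q q) := by
  obtain ⟨k, p, r, hp, hr⟩ := hP.exists_isRep₂ hQ
  exact (hp.mul hr).isDiffFun

lemma isDiffFun_const (c : ℝ) : IsDiffFun (cylinder m U) (fun _ => c) :=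
  (isRep_const m.lt_succ_self c).isDiffFun

lemma IsDiffFun.inv (hP : IsDiffFun (cylinder m U) P) (h0 : ∀ q ∈ cylinder m U, P q ≠ 0) :
    IsDiffFun (cylinder m U) (fun q => (P q)⁻¹) := by
  obtain ⟨k, p, -, hp, -⟩ := hP.exists_isRep₂ hP
  exact (hp.inv h0).isDiffFun

lemma IsDiffFun.congr (hP : IsDiffFun (cylinder m U) P) (h : ∀ q ∈ cylinder m U, Q q = P q) :
    IsDiffFun (cylinder m U) Q := by
  obtain ⟨k, p, -, hp, -⟩ := hP.exists_isRep₂ hP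
  exact (hp.congr h).isDiffFun

variable (m U) in
/-- The algebra of differential functions on a cylinder. -/
def diffAlg : Subalgebra ℝ (cylinder m U → ℝ) where
  carrier := {g | ∃ P, IsDiffFun (cylinder m U) P ∧ ∀ q, g q = P q}
  mul_mem' := by
    rintro f g ⟨P, hP, hf⟩ ⟨Q, hQ, hg⟩
    exact ⟨_, hP.mul hQ, fun q => by rw [Pi.mul_apply, hf, hg]⟩
  add_mem' := by
    rintro f g ⟨P, hP, hf⟩ ⟨Q, hQ, hg⟩
    exact ⟨_, hP.add hQ, fun q => by rw [Pi.add_apply, hf, hg]⟩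
  algebraMap_mem' c := ⟨_, isDiffFun_const c, fun _ => rfl⟩

/-- The class of a differential function. -/
def toAlg (P : Jet n → ℝ) (hP : IsDiffFun (cylinder m U) P) : diffAlg m U :=
  ⟨fun q => P q, P, hP, fun _ => rfl⟩

/-- An extension of an element of `diffAlg` to the whole jet space. -/
def lift (g : diffAlg m U) : Jet n → ℝ := g.2.choose

lemma isDiffFun_lift (g : diffAlg m U) : IsDiffFun (cylinder m U) (lift g) := g.2.choose_spec.1

lemma lift_apply (g : diffAlg m U) (q : cylinder m U) : lift g q = g.1 q :=
  (g.2.choose_spec.2 q).symm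

lemma toAlg_lift (g : diffAlg m U) : toAlg (lift g) (isDiffFun_lift g) = g :=
  Subtype.ext (funext fun q => lift_apply g q)

lemma toAlg_eq_iff {hP : IsDiffFun (cylinder m U) P} {hQ : IsDiffFun (cylinder m U) Q} :
    toAlg P hP = toAlg Q hQ ↔ ∀ q ∈ cylinder m U, P q = Q q :=
  ⟨fun h q hq => congrFun (congrArg Subtype.val h) ⟨q, hq⟩,
    fun h => Subtype.ext (funext fun q => h q q.2)⟩

/-- Elements of `diffAlg` are functions on the cylinder only. This is what makes `det ψ` a unit over
the regular set, so that `ψ` can be inverted inside the algebra. -/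
lemma isUnit_diffAlg {g : diffAlg m U} (h : ∀ q, g.1 q ≠ 0) : IsUnit g := by
  refine IsUnit.of_mul_eq_one (toAlg _ ((isDiffFun_lift g).inv (fun q hq => ?_))) ?_
  · rw [lift_apply g ⟨q, hq⟩]
    exact h _
  · refine Subtype.ext (funext fun q => ?_)
    change g.1 q * (lift g q)⁻¹ = 1
    rw [lift_apply, mul_inv_cancel₀ (h q)]

/-- `T` acts on differential functions as the vector field `w` on the jet space. -/
structure IsField (m : ℕ) (U : Set (Fin n → ℝ)) (T : (Jet n → ℝ) → Jet n → ℝ)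
    (w : Jet n → Jet n) : Prop where
  eq : ∀ {P k p}, IsRep m U k p P → ∀ q ∈ cylinder m U,
    T P q = fderiv ℝ p (jetTrunc k q) (jetTrunc k (w q))
  isDiffFun : ∀ {P}, IsDiffFun (cylinder m U) P → IsDiffFun (cylinder m U) (T P)

namespace IsField

variable {T : (Jet n → ℝ) → Jet n → ℝ} {w : Jet n → Jet n} (hT : IsField m U T w)
include hT

/-- Functions equal on the cylinder share a representative there, and `T` depends only on the
representative; hence `T` descends to `diffAlg`, independently of the extension chosen by `lift`. -/
lemma congr (hP : IsDiffFun (cylinder m U) P) (h : ∀ q ∈ cylinder m U, Q q = P q) :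
    ∀ q ∈ cylinder m U, T Q q = T P q := by
  obtain ⟨k, p, -, hp, -⟩ := hP.exists_isRep₂ hP
  intro q hq
  rw [hT.eq hp q hq, hT.eq (hp.congr h) q hq]

end IsField

/-- The derivation of `diffAlg` defined by a vector field. -/
def IsField.derivation (hU : IsOpen U) {T : (Jet n → ℝ) → Jet n → ℝ} {w : Jet n → Jet n}
    (hT : IsField m U T w) : Derivation ℝ (diffAlg m U) (diffAlg m U) :=
  Derivation.mk'
    { toFun := fun g => toAlg (T (lift g)) (hT.isDiffFun (isDiffFun_lift g))
      map_add' := fun f g => by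
        refine Subtype.ext (funext fun q => ?_)
        change T (lift (f + g)) q = T (lift f) q + T (lift g) q
        obtain ⟨k, p, r, hp, hr⟩ := (isDiffFun_lift f).exists_isRep₂ (isDiffFun_lift g)
        rw [hT.congr (hp.add hr).isDiffFun (fun q hq => by
            rw [lift_apply _ ⟨q, hq⟩, lift_apply _ ⟨q, hq⟩, lift_apply _ ⟨q, hq⟩]; rfl) q q.2,
          hT.eq (hp.add hr) q q.2, hT.eq hp q q.2, hT.eq hr q q.2,
          fderiv_fun_add (hp.differentiableAt hU q.2) (hr.differentiableAt hU q.2)]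
        rfl
      map_smul' := fun c f => by
        refine Subtype.ext (funext fun q => ?_)
        change T (lift (c • f)) q = c * T (lift f) q
        obtain ⟨k, p, -, hp, -⟩ := (isDiffFun_lift f).exists_isRep₂ (isDiffFun_lift f)
        have hr : IsRep m U k (fun x => c * p x) (fun q => c * lift f q) :=
          (isRep_const hp.lt c).mul hp
        rw [hT.congr hr.isDiffFun (fun q hq => by
            rw [lift_apply _ ⟨q, hq⟩, lift_apply _ ⟨q, hq⟩]; rfl) q q.2,
          hT.eq hr q q.2, hT.eq hp q q.2, fderiv_const_mul (hp.differentiableAt hU q.2)]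
        rfl }
    fun f g => by
      refine Subtype.ext (funext fun q => ?_)
      change T (lift (f * g)) q = f.1 q * T (lift g) q + g.1 q * T (lift f) q
      obtain ⟨k, p, r, hp, hr⟩ := (isDiffFun_lift f).exists_isRep₂ (isDiffFun_lift g)
      rw [hT.congr (hp.mul hr).isDiffFun (fun q hq => by
          rw [lift_apply _ ⟨q, hq⟩, lift_apply _ ⟨q, hq⟩, lift_apply _ ⟨q, hq⟩]; rfl) q q.2,
        hT.eq (hp.mul hr) q q.2, hT.eq hp q q.2, hT.eq hr q q.2,
        fderiv_fun_mul (hp.differentiableAt hU q.2) (hr.differentiableAt hU q.2),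
        ← lift_apply f, ← lift_apply g, hp.eq q q.2, hr.eq q q.2]
      rfl

lemma IsField.derivation_toAlg (hU : IsOpen U) {T : (Jet n → ℝ) → Jet n → ℝ} {w : Jet n → Jet n}
    (hT : IsField m U T w) (hP : IsDiffFun (cylinder m U) P) :
    hT.derivation hU (toAlg P hP) = toAlg (T P) (hT.isDiffFun hP) :=
  Subtype.ext (funext fun q => hT.congr hP
    (fun r hr => lift_apply (toAlg P hP) ⟨r, hr⟩) q q.2)

lemma isField_totalD (hU : IsOpen U) : IsField m U totalD jetShift where
  eq h _ hq := h.totalD_eq hU hq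
  isDiffFun h := by
    obtain ⟨k, p, -, hp, -⟩ := h.exists_isRep₂ h
    exact (hp.totalD hU).isDiffFun

lemma isField_partialU (hU : IsOpen U) (l : ℕ) (i : Fin n) :
    IsField m U (partialU l i) (fun _ => jetBasis l i) where
  eq h _ hq := h.partialU_eq hU hq l i
  isDiffFun h := by
    obtain ⟨k, p, -, hp, -⟩ := h.exists_isRep₂ h
    exact (hp.partialU hU l i).isDiffFun

variable (m) in
/-- Differential functions on a cylinder form a `JetAlgebra`. -/
def jetAlg (hU : IsOpen U) : JetAlgebra n (diffAlg m U) where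
  D := (isField_totalD hU).derivation hU
  d l i := (isField_partialU hU l i).derivation hU
  d_comm l i l' i' g := by
    obtain ⟨k, p, -, hp, -⟩ := (isDiffFun_lift g).exists_isRep₂ (isDiffFun_lift g)
    rw [← toAlg_lift g]
    simp only [IsField.derivation_toAlg]
    exact toAlg_eq_iff.2 fun q hq => hp.partialU_comm hU hq l i l' i'
  d_zero_D i g := by
    obtain ⟨k, p, -, hp, -⟩ := (isDiffFun_lift g).exists_isRep₂ (isDiffFun_lift g)
    rw [← toAlg_lift g]
    simp only [IsField.derivation_toAlg]
    refine toAlg_eq_iff.2 fun q hq => ?_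
    rw [hp.partialU_totalD hU hq, truncShift_jetBasis_zero, map_zero, add_zero]
  d_succ_D l i g := by
    obtain ⟨k, p, -, hp, -⟩ := (isDiffFun_lift g).exists_isRep₂ (isDiffFun_lift g)
    rw [← toAlg_lift g]
    simp only [IsField.derivation_toAlg]
    refine Subtype.ext (funext fun q => ?_)
    change partialU (l + 1) i (totalD (lift g)) q =
      totalD (partialU (l + 1) i (lift g)) q + partialU l i (lift g) q
    rw [hp.partialU_totalD hU q.2, truncShift_jetBasis_succ, hp.partialU_eq hU q.2 l i]
  exists_order g := by
    obtain ⟨k, p, -, hp, -⟩ := (isDiffFun_lift g).exists_isRep₂ (isDiffFun_lift g)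
    refine ⟨k, fun l hl i => Subtype.ext (funext fun q => ?_)⟩
    change partialU l i (lift g) q = 0
    rw [hp.partialU_eq hU q.2, jetTrunc_jetBasis_of_le hl, map_zero]

lemma D_toAlg (hU : IsOpen U) (hP : IsDiffFun (cylinder m U) P) :
    (jetAlg m hU).D (toAlg P hP) = toAlg (totalD P) ((isField_totalD hU).isDiffFun hP) :=
  (isField_totalD hU).derivation_toAlg hU hP

lemma d_toAlg (hU : IsOpen U) (hP : IsDiffFun (cylinder m U) P) (l : ℕ) (i : Fin n) :
    (jetAlg m hU).d l i (toAlg P hP) =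
      toAlg (partialU l i P) ((isField_partialU hU l i).isDiffFun hP) :=
  (isField_partialU hU l i).derivation_toAlg hU hP

lemma isDiffFun_iterate_totalD (hU : IsOpen U) (hP : IsDiffFun (cylinder m U) P) (k : ℕ) :
    IsDiffFun (cylinder m U) (totalD^[k] P) := by
  induction k with
  | zero => exact hP
  | succ k ih =>
    rw [Function.iterate_succ_apply']
    exact (isField_totalD hU).isDiffFun ih

lemma iterate_D_toAlg (hU : IsOpen U) (hP : IsDiffFun (cylinder m U) P) (k : ℕ) :
    (jetAlg m hU).D^[k] (toAlg P hP) = toAlg (totalD^[k] P) (isDiffFun_iterate_totalD hU hP k) := by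
  induction k with
  | zero => rfl
  | succ k ih =>
    rw [Function.iterate_succ_apply', ih, D_toAlg, toAlg_eq_iff]
    intro q _
    rw [Function.iterate_succ_apply']

lemma varDeriv_toAlg_apply (hU : IsOpen U) (hP : IsDiffFun (cylinder m U) P) (i : Fin n)
    (q : cylinder m U) : ((jetAlg m hU).varDeriv (toAlg P hP) i).1 q = varD i P q := by
  obtain ⟨K, hK⟩ := (jetAlg m hU).exists_order (toAlg P hP)
  have hterm : ∀ k, ((jetAlg m hU).D^[k] ((jetAlg m hU).d k i (toAlg P hP))).1 q =
      totalD^[k] (partialU k i P) q := fun k => by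
    rw [d_toAlg, iterate_D_toAlg]
    rfl
  rw [(jetAlg m hU).varDeriv_eq_sum hK, varD,
    finsum_eq_sum_of_support_subset (s := Finset.range K)]
  · rw [AddSubmonoidClass.coe_finsetSum, Finset.sum_apply]
    refine Finset.sum_congr rfl fun k _ => ?_
    rw [← hterm]
    simp
  · intro k hk
    by_contra hk'
    refine hk ?_
    beta_reduce
    rw [← hterm, hK k (by simpa using hk'), iterate_map_zero]
    simp

lemma isDiffFun_varD (hU : IsOpen U) (hP : IsDiffFun (cylinder m U) P) (i : Fin n) :
    IsDiffFun (cylinder m U) (varD i P) :=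
  (isDiffFun_lift ((jetAlg m hU).varDeriv (toAlg P hP) i)).congr fun q hq => by
    rw [lift_apply _ ⟨q, hq⟩, varDeriv_toAlg_apply]

lemma varDeriv_toAlg (hU : IsOpen U) (hP : IsDiffFun (cylinder m U) P) (i : Fin n) :
    (jetAlg m hU).varDeriv (toAlg P hP) i = toAlg (varD i P) (isDiffFun_varD hU hP i) :=
  Subtype.ext (funext fun q => varDeriv_toAlg_apply hU hP i q)

/-- A coordinate function on the jet space, as a continuous linear functional of truncated jets. -/
lemma isRep_coord {k l : ℕ} (hm : m < k) (hl : l < k) (i : Fin n) :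
    IsRep m U k (((ContinuousLinearMap.proj (φ := fun _ : Fin n => ℝ) i).comp
      (ContinuousLinearMap.proj (φ := fun _ : Fin k => Fin n → ℝ) ⟨l, hl⟩)).comp
        (ContinuousLinearMap.snd ℝ ℝ _)) (fun q : Jet n => q.2 l i) :=
  isRep_clm hm _

lemma isDiffFun_coord (l : ℕ) (i : Fin n) :
    IsDiffFun (cylinder m U) (fun q : Jet n => q.2 l i) :=
  (isRep_coord (k := max m l + 1) (by have := le_max_left m l; omega)
    (by have := le_max_right m l; omega) i).isDiffFun

lemma isRep_x : IsRep m U (m + 1) (ContinuousLinearMap.fst ℝ ℝ _) (fun q : Jet n => q.1) :=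
  isRep_clm m.lt_succ_self _

lemma isDiffFun_x : IsDiffFun (cylinder m U) (fun q : Jet n => q.1) := isRep_x.isDiffFun

variable (m U) in
/-- The coordinate `u^i_l` as an element of the algebra of differential functions. -/
def coordAlg (l : ℕ) (i : Fin n) : diffAlg m U := toAlg _ (isDiffFun_coord l i)

variable (m U) in
/-- The independent variable as an element of the algebra of differential functions. -/
def xAlg : diffAlg m U := toAlg _ isDiffFun_x

lemma D_coordAlg (hU : IsOpen U) (l : ℕ) (i : Fin n) :
    (jetAlg m hU).D (coordAlg m U l i) = coordAlg m U (l + 1) i := by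
  rw [coordAlg, D_toAlg, coordAlg, toAlg_eq_iff]
  intro q hq
  rw [(isField_totalD hU).eq (isRep_coord (k := max m l + 1) (by have := le_max_left m l; omega)
    (by have := le_max_right m l; omega) i) q hq, ContinuousLinearMap.fderiv]
  rfl

lemma D_xAlg (hU : IsOpen U) : (jetAlg m hU).D (xAlg m U) = 1 := by
  rw [xAlg, D_toAlg]
  refine Subtype.ext (funext fun q => ?_)
  change totalD (fun q => q.1) q.1 = 1
  rw [(isField_totalD hU).eq isRep_x q q.2, ContinuousLinearMap.fderiv]
  rfl

lemma d_coordAlg (hU : IsOpen U) (k : ℕ) (j : Fin n) (l : ℕ) (i : Fin n) :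
    (jetAlg m hU).d k j (coordAlg m U l i) = if l = k ∧ i = j then 1 else 0 := by
  have h : ∀ q : cylinder m U, partialU k j (fun q => q.2 l i) q.1 =
      if l = k ∧ i = j then 1 else 0 := by
    intro q
    rw [(isField_partialU hU k j).eq (isRep_coord (k := max m l + 1)
      (by have := le_max_left m l; omega) (by have := le_max_right m l; omega) i) q q.2,
      ContinuousLinearMap.fderiv]
    change (jetBasis k j).2 l i = _
    by_cases hl : l = k
    · subst hl
      simp [jetBasis, Pi.single_apply]
    · simp [jetBasis, hl]
  rw [coordAlg, d_toAlg]
  refine Subtype.ext (funext fun q => (h q).trans ?_)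
  split_ifs <;> rfl

lemma d_xAlg (hU : IsOpen U) (k : ℕ) (j : Fin n) : (jetAlg m hU).d k j (xAlg m U) = 0 := by
  rw [xAlg, d_toAlg]
  refine Subtype.ext (funext fun q => ?_)
  change partialU _ _ (fun q => q.1) q.1 = 0
  rw [(isField_partialU hU k j).eq isRep_x q q.2, ContinuousLinearMap.fderiv]
  rfl

lemma evolve_coordAlg (hU : IsOpen U) (X : Fin n → diffAlg m U) :
    (jetAlg m hU).evolve X ∘ coordAlg m U 0 = X := by
  funext i
  rw [Function.comp_apply, JetAlgebra.evolve_eq_sum (K := 1)]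
  · simp [d_coordAlg]
  · intro k hk j
    rw [d_coordAlg, if_neg (by omega)]

end

/-! ### Monge metrics and the factorization of the third-order operator. -/

section

variable {n : ℕ}

namespace LineCongruence

/-- The algebraic conditions on `φ` and `ψ` under which `φ_{αβ} ψ^α_i ψ^β_j` defines a third-order
Hamiltonian operator. -/
structure IsMonge (C : LineCongruence n) (φ : Matrix (Fin n) (Fin n) ℝ) : Prop where
  symm : φᵀ = φ
  det_ne_zero : φ.det ≠ 0
  skew : ∀ γ i k, C.psi γ k i = -C.psi γ i k
  cyclic : ∀ u i j k, ∑ γ, (φ * C.psiMat u) γ i * C.psi γ j k +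
    ∑ γ, (φ * C.psiMat u) γ j * C.psi γ k i + ∑ γ, (φ * C.psiMat u) γ k * C.psi γ i j = 0

variable {C : LineCongruence n} {φ : Matrix (Fin n) (Fin n) ℝ}

lemma hasFDerivAt_psiMat (C : LineCongruence n) (u : Fin n → ℝ) (γ i : Fin n) :
    HasFDerivAt (fun w => C.psiMat w γ i)
      (∑ k, C.psi γ i k • ContinuousLinearMap.proj (R := ℝ) (φ := fun _ : Fin n => ℝ) k) u := by
  have h : HasFDerivAt (fun w : Fin n → ℝ => ∑ k, C.psi γ i k * w k)
      (∑ k, C.psi γ i k • ContinuousLinearMap.proj (R := ℝ) (φ := fun _ : Fin n => ℝ) k) u :=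
    HasFDerivAt.fun_sum fun k _ => (hasFDerivAt_apply k u).const_mul _
  exact h.add_const _

lemma continuous_psiMat (C : LineCongruence n) : Continuous C.psiMat :=
  continuous_matrix fun γ i => continuous_iff_continuousAt.2 fun u =>
    (C.hasFDerivAt_psiMat u γ i).continuousAt

lemma isOpen_regular (C : LineCongruence n) : IsOpen C.regular :=
  isOpen_ne.preimage (Continuous.matrix_det C.continuous_psiMat)

lemma fderiv_monge (hC : C.IsMonge φ) (u : Fin n → ℝ) (s k m : Fin n) :
    fderiv ℝ (fun w => C.monge φ w s m) u (Pi.single k 1) =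
      ∑ γ, (φ * C.psiMat u) γ m * C.psi γ s k + ∑ γ, (φ * C.psiMat u) γ s * C.psi γ m k := by
  have hf : (fun w => C.monge φ w s m) =
      fun w => ∑ β, ∑ α, C.psiMat w α s * φ α β * C.psiMat w β m := by
    ext w
    simp only [monge, Matrix.mul_apply, Matrix.transpose_apply, Finset.sum_mul]
  have hd := HasFDerivAt.fun_sum (u := Finset.univ) fun β _ => HasFDerivAt.fun_sum
    (u := Finset.univ) fun α _ => ((C.hasFDerivAt_psiMat u α s).mul_const (φ α β)).fun_mul
      (C.hasFDerivAt_psiMat u β m)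
  have hsum : ∀ (c : Fin n → ℝ), (∑ x, c x * (Pi.single k (1 : ℝ) : Fin n → ℝ) x) = c k := by
    intro c
    simp [Pi.single_apply]
  have hφ : ∀ α β, φ α β = φ β α := fun α β => congrFun (congrFun hC.symm β) α
  rw [hf, hd.fderiv]
  simp only [_root_.sum_apply, _root_.add_apply, _root_.smul_apply,
    ContinuousLinearMap.proj_apply, smul_eq_mul, hsum, Finset.sum_add_distrib, Matrix.mul_apply,
    Finset.sum_mul]
  rw [add_comm]
  congr 1
  · rw [Finset.sum_comm]
    exact Finset.sum_congr rfl fun _ _ => Finset.sum_congr rfl fun _ _ => by ring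
  · refine Finset.sum_congr rfl fun β _ => Finset.sum_congr rfl fun α _ => ?_
    rw [hφ α β]
    ring

/-- With `N = φψ`, skewness of `ψ` turns `f_{sm,k} - f_{sk,m}` into `N_m ψ_{sk} + N_k ψ_{ms} - 2 N_s
ψ_{km}`, and the cyclic identity makes this `-3 N_s ψ_{km}`. The normalization `1/3` of `c` is thus
the right one. -/
lemma lowerC_monge (hC : C.IsMonge φ) (u : Fin n → ℝ) (s k m : Fin n) :
    lowerC (C.monge φ) u s k m = -∑ γ, (φ * C.psiMat u) γ s * C.psi γ k m := by
  have hskew : ∀ a i k, ∑ γ, (φ * C.psiMat u) γ a * C.psi γ k i =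
      -∑ γ, (φ * C.psiMat u) γ a * C.psi γ i k := fun a i k => by
    rw [← Finset.sum_neg_distrib]
    exact Finset.sum_congr rfl fun γ _ => by rw [hC.skew γ i k]; ring
  rw [lowerC, fderiv_monge hC, fderiv_monge hC, hskew s k m, hskew k m s]
  linarith [hC.cyclic u s k m]

lemma monge_inv_mul (φ : Matrix (Fin n) (Fin n) ℝ) {u : Fin n → ℝ} (hu : u ∈ C.regular) :
    (C.monge φ u)⁻¹ * (C.psiMat u)ᵀ = (C.psiMat u)⁻¹ * φ⁻¹ := by
  have hA : IsUnit (C.psiMat u)ᵀ.det := by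
    rw [Matrix.det_transpose]
    exact isUnit_iff_ne_zero.2 hu
  rw [monge, Matrix.mul_inv_rev, Matrix.mul_inv_rev, Matrix.mul_assoc, Matrix.mul_assoc,
    Matrix.nonsing_inv_mul _ hA, Matrix.mul_one]

lemma upperC_monge (hC : C.IsMonge φ) {u : Fin n → ℝ} (hu : u ∈ C.regular) (p q k : Fin n) :
    upperC (C.monge φ) u p q k =
      -∑ j, ∑ γ, (C.monge φ u)⁻¹ p j * (C.psiMat u)⁻¹ q γ * C.psi γ j k := by
  have h : (C.monge φ u)⁻¹ * (φ * C.psiMat u)ᵀ = (C.psiMat u)⁻¹ := by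
    rw [Matrix.transpose_mul, ← Matrix.mul_assoc, monge_inv_mul φ hu, hC.symm, Matrix.mul_assoc,
      Matrix.nonsing_inv_mul _ (isUnit_iff_ne_zero.2 hC.det_ne_zero), Matrix.mul_one]
  have h' : ∀ γ, ∑ i, (C.monge φ u)⁻¹ q i * (φ * C.psiMat u) γ i = (C.psiMat u)⁻¹ q γ :=
    fun γ => congrFun (congrFun h q) γ
  simp only [upperC, lowerC_monge hC, ← h', Finset.mul_sum, Finset.sum_mul, mul_neg,
    Finset.sum_neg_distrib]
  rw [Finset.sum_comm]
  refine congrArg _ (Finset.sum_congr rfl fun j _ => ?_)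
  rw [Finset.sum_comm]
  exact Finset.sum_congr rfl fun γ _ => Finset.sum_congr rfl fun i _ => by ring

/-- The inner operator is `ψ⁻¹ φ⁻¹ D ψ⁻ᵀ`. -/
lemma sum_monge_inv_add_upperC (hC : C.IsMonge φ) {u : Fin n → ℝ} (hu : u ∈ C.regular)
    {u₁ π π' s s' b : Fin n → ℝ} (hs : (C.psiMat u)ᵀ *ᵥ s = π)
    (hs' : (linMat C.psi u₁)ᵀ *ᵥ s + (C.psiMat u)ᵀ *ᵥ s' = π')
    (hb : C.psiMat u *ᵥ b = φ⁻¹ *ᵥ s') (i : Fin n) :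
    ∑ j, ((C.monge φ u)⁻¹ i j * π' j + (∑ k, upperC (C.monge φ) u i j k * u₁ k) * π j) = b i := by
  have hA : IsUnit (C.psiMat u).det := isUnit_iff_ne_zero.2 hu
  have hsπ : ∀ γ, ∑ j, (C.psiMat u)⁻¹ j γ * π j = s γ := by
    intro γ
    have : ((C.psiMat u)⁻¹)ᵀ *ᵥ π = s := by
      rw [← hs, Matrix.mulVec_mulVec, ← Matrix.transpose_mul, Matrix.mul_nonsing_inv _ hA,
        Matrix.transpose_one, Matrix.one_mulVec]
    exact congrFun this γ
  -- The `c`-term accounts for the derivative of `ψ⁻ᵀ`: with `s = ψ⁻ᵀ π`, one has `D s = ψ⁻ᵀ (D π -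
  -- ψ(u_x)ᵀ s)`, and `ψ⁻¹ φ⁻¹ ψ⁻ᵀ = f⁻¹`.
  have h1 : ∑ j, (∑ k, upperC (C.monge φ) u i j k * u₁ k) * π j =
      -((C.monge φ u)⁻¹ *ᵥ ((linMat C.psi u₁)ᵀ *ᵥ s)) i := by
    simp only [upperC_monge hC hu, Matrix.mulVec, dotProduct, Matrix.transpose_apply, linMat,
      Matrix.of_apply, smul_eq_mul, Finset.sum_mul, Finset.mul_sum, neg_mul,
      Finset.sum_neg_distrib, ← hsπ]
    congr 1
    calc _ = ∑ j, ∑ l, ∑ k, ∑ γ, (C.monge φ u)⁻¹ i l * (C.psiMat u)⁻¹ j γ * C.psi γ l k * u₁ k *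
              π j :=
          Finset.sum_congr rfl fun j _ => Finset.sum_comm
      _ = ∑ l, ∑ j, ∑ k, ∑ γ, (C.monge φ u)⁻¹ i l * (C.psiMat u)⁻¹ j γ * C.psi γ l k * u₁ k *
              π j := Finset.sum_comm
      _ = _ := by
          refine Finset.sum_congr rfl fun l _ => ?_
          calc _ = ∑ j, ∑ γ, ∑ k, (C.monge φ u)⁻¹ i l * (C.psiMat u)⁻¹ j γ * C.psi γ l k * u₁ k *
                  π j := Finset.sum_congr rfl fun j _ => Finset.sum_comm
            _ = ∑ γ, ∑ j, ∑ k, (C.monge φ u)⁻¹ i l * (C.psiMat u)⁻¹ j γ * C.psi γ l k * u₁ k *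
                  π j := Finset.sum_comm
            _ = _ := Finset.sum_congr rfl fun γ _ => Finset.sum_congr rfl fun j _ =>
                  Finset.sum_congr rfl fun k _ => by ring
  have h2 : (C.monge φ u)⁻¹ *ᵥ π' - (C.monge φ u)⁻¹ *ᵥ ((linMat C.psi u₁)ᵀ *ᵥ s) = b := by
    rw [← Matrix.mulVec_sub, ← hs', add_sub_cancel_left, Matrix.mulVec_mulVec,
      monge_inv_mul φ hu, ← Matrix.mulVec_mulVec, ← hb, Matrix.mulVec_mulVec,
      Matrix.nonsing_inv_mul _ hA, Matrix.one_mulVec]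
  rw [Finset.sum_add_distrib, h1, ← h2]
  rfl

end LineCongruence

section Eval

variable {m : ℕ} {U : Set (Fin n → ℝ)}

/-- Evaluation of differential functions at a point of the jet space. -/
def evalAlg (q : cylinder m U) : diffAlg m U →ₐ[ℝ] ℝ :=
  (Pi.evalAlgHom ℝ (fun _ => ℝ) q).comp (diffAlg m U).val

lemma evalAlg_toAlg {P : Jet n → ℝ} (hP : IsDiffFun (cylinder m U) P) (q : cylinder m U) :
    evalAlg q (toAlg P hP) = P q := rfl

lemma evalAlg_ext {f g : diffAlg m U} (h : ∀ q, evalAlg q f = evalAlg q g) : f = g :=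
  Subtype.ext (funext h)

variable {R : Type*} [CommRing R] [Algebra ℝ R] (e : R →ₐ[ℝ] ℝ)

lemma algHom_dotProduct (v w : Fin n → R) : e (v ⬝ᵥ w) = (e ∘ v) ⬝ᵥ (e ∘ w) := by
  simp [dotProduct]

lemma algHom_mulVec (M : Matrix (Fin n) (Fin n) R) (v : Fin n → R) :
    e ∘ (M *ᵥ v) = M.map e *ᵥ (e ∘ v) :=
  funext fun i => algHom_dotProduct e (M i) v

lemma algHom_linMat (psi : Fin n → Matrix (Fin n) (Fin n) ℝ) (X : Fin n → R) :
    (linMat psi X).map e = linMat psi (e ∘ X) := by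
  ext γ i
  simp [linMat]

lemma algHom_constMat (M : Matrix (Fin n) (Fin n) ℝ) : (M.map (algebraMap ℝ R)).map e = M := by
  ext γ i
  simp

lemma algHom_affMat (C : LineCongruence n) (u : Fin n → R) :
    (affMat C.psi C.omega u).map e = C.psiMat (e ∘ u) := by
  ext γ i
  simp [affMat, linMat, LineCongruence.psiMat]

end Eval

namespace LineCongruence

variable {C : LineCongruence n} {φ : Matrix (Fin n) (Fin n) ℝ}

lemma cyclic_trilinear {N : Matrix (Fin n) (Fin n) ℝ} (hN : ∀ i j k, ∑ γ, N γ i * C.psi γ j k +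
    ∑ γ, N γ j * C.psi γ k i + ∑ γ, N γ k * C.psi γ i j = 0) (x y z : Fin n → ℝ) :
    (N *ᵥ x) ⬝ᵥ (linMat C.psi z *ᵥ y) + (N *ᵥ y) ⬝ᵥ (linMat C.psi x *ᵥ z) +
      (N *ᵥ z) ⬝ᵥ (linMat C.psi y *ᵥ x) = 0 := by
  have key : ∀ x y z : Fin n → ℝ, (N *ᵥ x) ⬝ᵥ (linMat C.psi z *ᵥ y) =
      ∑ i, ∑ j, ∑ k, x i * y j * z k * ∑ γ, N γ i * C.psi γ j k := by
    intro x y z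
    simp only [Matrix.mulVec, dotProduct, linMat, Matrix.of_apply, smul_eq_mul, Finset.sum_mul]
    simp only [Finset.mul_sum]
    calc _ = ∑ j, ∑ i, ∑ γ, ∑ k, N γ i * x i * (C.psi γ j k * z k * y j) := by
          calc _ = ∑ γ, ∑ j, ∑ i, ∑ k,
                N γ i * x i * (C.psi γ j k * z k * y j) := by
                refine Finset.sum_congr rfl fun γ _ => ?_
                rw [Finset.sum_comm]
            _ = ∑ j, ∑ γ, ∑ i, ∑ k,
                N γ i * x i * (C.psi γ j k * z k * y j) := Finset.sum_comm
            _ = _ := Finset.sum_congr rfl fun j _ => Finset.sum_comm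
      _ = ∑ i, ∑ j, ∑ γ, ∑ k, N γ i * x i * (C.psi γ j k * z k * y j) :=
          Finset.sum_comm
      _ = _ := by
          refine Finset.sum_congr rfl fun i _ => Finset.sum_congr rfl fun j _ => ?_
          rw [Finset.sum_comm]
          exact Finset.sum_congr rfl fun k _ => Finset.sum_congr rfl fun γ _ => by ring
  have h2 : (N *ᵥ y) ⬝ᵥ (linMat C.psi x *ᵥ z) =
      ∑ i, ∑ j, ∑ k, x i * y j * z k * ∑ γ, N γ j * C.psi γ k i := by
    rw [key y z x]
    calc _ = ∑ j, ∑ i, ∑ k, y j * z k * x i * ∑ γ, N γ j * C.psi γ k i :=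
          Finset.sum_congr rfl fun j _ => Finset.sum_comm
      _ = _ := Finset.sum_comm
      _ = _ := Finset.sum_congr rfl fun i _ => Finset.sum_congr rfl fun j _ =>
          Finset.sum_congr rfl fun k _ => by ring
  have h3 : (N *ᵥ z) ⬝ᵥ (linMat C.psi y *ᵥ x) =
      ∑ i, ∑ j, ∑ k, x i * y j * z k * ∑ γ, N γ k * C.psi γ i j := by
    rw [key z x y, Finset.sum_comm]
    refine Finset.sum_congr rfl fun i _ => ?_
    rw [Finset.sum_comm]
    exact Finset.sum_congr rfl fun j _ => Finset.sum_congr rfl fun k _ => by ring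
  have hc : ∀ i j k, ∑ γ, (N γ i * C.psi γ j k +
      N γ j * C.psi γ k i + N γ k * C.psi γ i j) = 0 := by
    intro i j k
    rw [Finset.sum_add_distrib, Finset.sum_add_distrib, hN]
  rw [key, h2, h3]
  simp only [← Finset.sum_add_distrib, ← mul_add, hc, mul_zero, Finset.sum_const_zero]

section

variable {m : ℕ}

/-- The matrix `ψ^γ_i(u)` over the algebra of differential functions. -/
abbrev psiAlg (C : LineCongruence n) (m : ℕ) :
    Matrix (Fin n) (Fin n) (diffAlg m C.regular) :=
  affMat C.psi C.omega (coordAlg m C.regular m)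

lemma map_psiAlg (q : cylinder m C.regular) :
    (C.psiAlg m).map (evalAlg q) = C.psiMat (q.1.2 m) :=
  algHom_affMat (evalAlg q) C _

lemma isUnit_det_psiAlg : IsUnit (C.psiAlg m).det := by
  refine isUnit_diffAlg fun q => ?_
  have h : evalAlg q (C.psiAlg m).det = (C.psiMat (q.1.2 m)).det := by
    rw [← map_psiAlg q, AlgHom.map_det]
    rfl
  exact fun h0 => q.2 (h.symm.trans h0)

variable (C φ) in
lemma exists_factorization (a : Fin n → diffAlg m C.regular) :
    ∃ s b, (jetAlg m C.isOpen_regular).IsFactorization (C.psiAlg m)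
      (φ⁻¹.map (algebraMap ℝ (diffAlg m C.regular))) a s b := by
  have h := isUnit_det_psiAlg (C := C) (m := m)
  set D := (jetAlg m C.isOpen_regular).D
  set K := φ⁻¹.map (algebraMap ℝ (diffAlg m C.regular))
  refine ⟨((C.psiAlg m)ᵀ)⁻¹ *ᵥ (D ∘ a),
    (C.psiAlg m)⁻¹ *ᵥ (K *ᵥ (D ∘ (((C.psiAlg m)ᵀ)⁻¹ *ᵥ (D ∘ a)))), ?_, ?_⟩
  · rw [Matrix.mulVec_mulVec, Matrix.mul_nonsing_inv _ (by rwa [Matrix.det_transpose]),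
      Matrix.one_mulVec]
  · rw [Matrix.mulVec_mulVec, Matrix.mul_nonsing_inv _ h, Matrix.one_mulVec]

/-- Needed for two values of `m`: on jets of `u` for the bracket (`m = 0`), and on jets of the
potential `b`, where `u` sits at order one, for the Hamiltonian system (`m = 1`). -/
lemma innerOp_monge (hC : C.IsMonge φ) {π : Fin n → Jet n → ℝ}
    (hπ : ∀ j, IsDiffFun (cylinder m C.regular) (π j)) {s b : Fin n → diffAlg m C.regular}
    (hs : (C.psiAlg m)ᵀ *ᵥ s = fun j => toAlg (π j) (hπ j))
    (hb : C.psiAlg m *ᵥ b = φ⁻¹.map (algebraMap ℝ _) *ᵥ ((jetAlg m C.isOpen_regular).D ∘ s))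
    (q : cylinder m C.regular) (i : Fin n) :
    innerOp (C.monge φ) (fun r => r.2 m) (fun r => r.2 (m + 1)) π i q = evalAlg q (b i) := by
  have hD : (jetAlg m C.isOpen_regular).D ∘ coordAlg m C.regular m = coordAlg m C.regular (m + 1) :=
    funext fun i => D_coordAlg _ m i
  have hs1 := congrArg (evalAlg q ∘ ·) hs
  -- Applying `D` to `ψᵀ s = π` before evaluating yields the equation for `D π` that the pointwise
  -- computation requires.
  have hs2 := congrArg ((evalAlg q) ∘ ⇑(jetAlg m C.isOpen_regular).D ∘ ·) hs
  have hb1 := congrArg (evalAlg q ∘ ·) hb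
  simp only [algHom_mulVec, Matrix.transpose_map, map_psiAlg, algHom_constMat] at hs1 hb1
  simp only [derivation_mulVec, Matrix.transpose_map, map_affMat, hD] at hs2
  have hs3 : evalAlg q ∘ ((linMat C.psi (coordAlg m C.regular (m + 1)))ᵀ *ᵥ s +
      (C.psiAlg m)ᵀ *ᵥ ((jetAlg m C.isOpen_regular).D ∘ s)) =
      evalAlg q ∘ ((linMat C.psi (coordAlg m C.regular (m + 1)))ᵀ *ᵥ s) +
      evalAlg q ∘ ((C.psiAlg m)ᵀ *ᵥ ((jetAlg m C.isOpen_regular).D ∘ s)) :=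
    funext fun i => map_add (evalAlg q) _ _
  rw [hs3] at hs2
  simp only [algHom_mulVec, Matrix.transpose_map, map_psiAlg, algHom_linMat] at hs2
  have hπ' : evalAlg q ∘ ⇑(jetAlg m C.isOpen_regular).D ∘ (fun j => toAlg (π j) (hπ j)) =
      fun j => totalD (π j) q := funext fun j => by
    simp only [Function.comp_apply, D_toAlg, evalAlg_toAlg]
  rw [hπ'] at hs2
  exact sum_monge_inv_add_upperC hC q.2 hs1 hs2 hb1 i

end

/-- The Monge metric of a congruence defines a third-order Hamiltonian operator. -/
theorem IsMonge.isThirdOrderHamiltonian (hC : C.IsMonge φ) :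
    IsThirdOrderHamiltonian C.regular (C.monge φ) := by
  refine ⟨fun u hu => ⟨?_, ?_⟩, ?_⟩
  · rw [Matrix.IsSymm, monge, Matrix.transpose_mul, Matrix.transpose_mul,
      Matrix.transpose_transpose, hC.symm, Matrix.mul_assoc]
  · rw [monge, Matrix.det_mul, Matrix.det_mul, Matrix.det_transpose]
    exact mul_ne_zero (mul_ne_zero hu hC.det_ne_zero) hu
  have hU := C.isOpen_regular
  set S := jetAlg 0 hU
  choose s b hsb using C.exists_factorization (m := 0) φ
  have hK : (φ⁻¹)ᵀ = φ⁻¹ := by rw [Matrix.transpose_nonsing_inv, hC.symm]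
  -- On the cylinder the third-order operator is `D` applied to the last stage `b` of the
  -- factorization, so the bracket becomes the abstract one.
  have hop : ∀ Q (hQ : IsDiffFun (cylinder 0 C.regular) Q) (q : cylinder 0 C.regular) (i : Fin n),
      thirdOrderOp (C.monge φ) (fun j => varD j Q) i q =
        evalAlg q (S.D (b (S.varDeriv (toAlg Q hQ)) i)) := by
    intro Q hQ q i
    have hv : ∀ j, IsDiffFun (cylinder 0 C.regular) (totalD (varD j Q)) := fun j =>
      (isField_totalD hU).isDiffFun (isDiffFun_varD hU hQ j)
    have hf := hsb (S.varDeriv (toAlg Q hQ))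
    have hleft := hf.left
    have hD : S.D ∘ S.varDeriv (toAlg Q hQ) = fun j => toAlg (totalD (varD j Q)) (hv j) :=
      funext fun j => by rw [Function.comp_apply, varDeriv_toAlg, D_toAlg]
    rw [hD] at hleft
    rw [← toAlg_lift (b _ i), D_toAlg, evalAlg_toAlg, thirdOrderOp]
    refine (isField_totalD hU).congr (isDiffFun_lift _) (fun r hr => ?_) q q.2
    rw [innerOp_monge hC hv hleft hf.right ⟨r, hr⟩ i, lift_apply _ ⟨r, hr⟩]
    rfl
  have hbr : ∀ P Q (hP : IsDiffFun (cylinder 0 C.regular) P)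
      (hQ : IsDiffFun (cylinder 0 C.regular) Q) (q : cylinder 0 C.regular),
      bracket (thirdOrderOp (C.monge φ)) P Q q =
        evalAlg q (S.varDeriv (toAlg P hP) ⬝ᵥ (S.D ∘ b (S.varDeriv (toAlg Q hQ)))) := by
    intro P Q hP hQ q
    rw [algHom_dotProduct, bracket]
    refine Finset.sum_congr rfl fun i _ => ?_
    rw [hop Q hQ q i, Function.comp_apply, varDeriv_toAlg, evalAlg_toAlg]
    rfl
  have hbrD : ∀ P Q, IsDiffFun (cylinder 0 C.regular) P → IsDiffFun (cylinder 0 C.regular) Q →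
      IsDiffFun (cylinder 0 C.regular) (bracket (thirdOrderOp (C.monge φ)) P Q) :=
    fun P Q hP hQ => (isDiffFun_lift _).congr fun q hq => by
      rw [hbr P Q hP hQ ⟨q, hq⟩, ← toAlg_lift (_ ⬝ᵥ _), evalAlg_toAlg]
  have hbrA : ∀ P Q (hP : IsDiffFun (cylinder 0 C.regular) P)
      (hQ : IsDiffFun (cylinder 0 C.regular) Q),
      toAlg (bracket (thirdOrderOp (C.monge φ)) P Q) (hbrD P Q hP hQ) =
        S.varDeriv (toAlg P hP) ⬝ᵥ (S.D ∘ b (S.varDeriv (toAlg Q hQ))) :=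
    fun P Q hP hQ => evalAlg_ext fun q => hbr P Q hP hQ q
  have htot : ∀ (P : Jet n → ℝ) (g : diffAlg 0 C.regular),
      (∀ q : cylinder 0 C.regular, P q = evalAlg q g) → S.integral g = 0 →
      IsTotalDerivative (cylinder 0 C.regular) P := by
    intro P g hPg hg
    obtain ⟨T, rfl⟩ := S.integral_eq_zero_iff.1 hg
    refine ⟨lift T, isDiffFun_lift T, fun q hq => ?_⟩
    rw [hPg ⟨q, hq⟩]
    rfl
  refine ⟨fun P Q hP hQ => ?_, fun P Q R hP hQ hR => ?_⟩
  · refine htot _ _ (fun q => ?_)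
      ((hsb (S.varDeriv (toAlg P hP))).skew hK (hsb (S.varDeriv (toAlg Q hQ))))
    rw [map_add, hbr P Q hP hQ, hbr Q P hQ hP]
  · have hφ : φ * φ⁻¹ = 1 := Matrix.mul_nonsing_inv _ (isUnit_iff_ne_zero.2 hC.det_ne_zero)
    refine htot _ _ (fun q => ?_) (JetAlgebra.jacobi (S := S) hK hφ hC.skew
      (evolve_coordAlg hU) (fun x y z => evalAlg_ext fun q => ?_)
      (hsb (S.varDeriv (toAlg P hP))) (hsb (S.varDeriv (toAlg Q hQ)))
      (hsb (S.varDeriv (toAlg R hR))))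
    · rw [map_add, map_add, ← hbrA P Q hP hQ, ← hbrA Q R hQ hR, ← hbrA R P hR hP,
        ← hbr _ R (hbrD P Q hP hQ) hR, ← hbr _ P (hbrD Q R hQ hR) hP,
        ← hbr _ Q (hbrD R P hR hP) hQ]
    · simp only [map_add, algHom_dotProduct, algHom_mulVec, algHom_constMat, algHom_linMat,
        map_psiAlg, map_zero]
      have h := cyclic_trilinear (hC.cyclic (q.1.2 0)) (evalAlg q ∘ x) (evalAlg q ∘ y)
        (evalAlg q ∘ z)
      simp only [← Matrix.mulVec_mulVec] at h
      exact h

end LineCongruence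

end

/-! ### The Hamiltonian density of a Monge system. -/

section

variable {n : ℕ}

namespace LineCongruence

/-- The algebraic conditions under which the system `u_t = (V(u))_x` defined by a congruence is
Hamiltonian with respect to the operator defined by its Monge metric. -/
structure IsMongeSystem (C : LineCongruence n) (φ : Matrix (Fin n) (Fin n) ℝ) : Prop
    extends C.IsMonge φ where
  theta_cyclic : ∀ i j k, ∑ γ, (φ * C.theta) γ i * C.psi γ j k +
    ∑ γ, (φ * C.theta) γ j * C.psi γ k i + ∑ γ, (φ * C.theta) γ k * C.psi γ i j = 0
  xi_skew : ∀ j l, (C.omegaᵀ * (φ * C.theta)) j l - (C.omegaᵀ * (φ * C.theta)) l j =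
    ∑ γ, C.psi γ j l * (φ *ᵥ C.xi) γ

section Energy

variable {R : Type*} [CommRing R] [Algebra ℝ R] (C : LineCongruence n)
  (φ : Matrix (Fin n) (Fin n) ℝ)

/-- The Hamiltonian density (up to the factor `-1/6`) of a Monge system, in terms of the potentials
`b`, their derivatives `u` and the independent variable `x`. -/
def energy (b u : Fin n → R) (x : R) : R :=
  2 * ((linMat C.psi u *ᵥ b) ⬝ᵥ ((φ * C.theta).map (algebraMap ℝ R) *ᵥ b)) +
  3 * (x * ((linMat C.psi u *ᵥ b) ⬝ᵥ (algebraMap ℝ R ∘ (φ *ᵥ C.xi)))) +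
  3 * ((C.omega.map (algebraMap ℝ R) *ᵥ b) ⬝ᵥ ((φ * C.theta).map (algebraMap ℝ R) *ᵥ b)) +
  6 * (x * ((C.omega.map (algebraMap ℝ R) *ᵥ b) ⬝ᵥ (algebraMap ℝ R ∘ (φ *ᵥ C.xi))))

lemma derivation_const_comp (δ : Derivation ℝ R R) (z : Fin n → ℝ) :
    δ ∘ (algebraMap ℝ R ∘ z) = 0 :=
  funext fun i => δ.map_algebraMap (z i)

lemma derivation_energy (δ : Derivation ℝ R R) (b u : Fin n → R) (x : R) :
    δ (C.energy φ b u x) =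
      2 * ((linMat C.psi (δ ∘ u) *ᵥ b) ⬝ᵥ ((φ * C.theta).map (algebraMap ℝ R) *ᵥ b) +
        (linMat C.psi u *ᵥ (δ ∘ b)) ⬝ᵥ ((φ * C.theta).map (algebraMap ℝ R) *ᵥ b) +
        (linMat C.psi u *ᵥ b) ⬝ᵥ ((φ * C.theta).map (algebraMap ℝ R) *ᵥ (δ ∘ b))) +
      3 * (δ x * ((linMat C.psi u *ᵥ b) ⬝ᵥ (algebraMap ℝ R ∘ (φ *ᵥ C.xi))) +
        x * ((linMat C.psi (δ ∘ u) *ᵥ b) ⬝ᵥ (algebraMap ℝ R ∘ (φ *ᵥ C.xi)) +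
        (linMat C.psi u *ᵥ (δ ∘ b)) ⬝ᵥ (algebraMap ℝ R ∘ (φ *ᵥ C.xi)))) +
      3 * ((C.omega.map (algebraMap ℝ R) *ᵥ (δ ∘ b)) ⬝ᵥ
          ((φ * C.theta).map (algebraMap ℝ R) *ᵥ b) +
        (C.omega.map (algebraMap ℝ R) *ᵥ b) ⬝ᵥ
          ((φ * C.theta).map (algebraMap ℝ R) *ᵥ (δ ∘ b))) +
      6 * (δ x * ((C.omega.map (algebraMap ℝ R) *ᵥ b) ⬝ᵥ (algebraMap ℝ R ∘ (φ *ᵥ C.xi))) +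
        x * ((C.omega.map (algebraMap ℝ R) *ᵥ (δ ∘ b)) ⬝ᵥ
          (algebraMap ℝ R ∘ (φ *ᵥ C.xi)))) := by
  have h2 : δ 2 = 0 := by simpa using δ.map_natCast 2
  have h3 : δ 3 = 0 := by simpa using δ.map_natCast 3
  have h6 : δ 6 = 0 := by simpa using δ.map_natCast 6
  simp only [energy, map_add, Derivation.leibniz, smul_eq_mul, derivation_dotProduct,
    derivation_mulVec, map_linMat, map_constMat, Matrix.zero_mulVec, zero_add,
    derivation_const_comp, dotProduct_zero, add_zero, add_dotProduct, h2, h3, h6]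
  ring

end Energy

variable {C : LineCongruence n} {φ : Matrix (Fin n) (Fin n) ℝ} {m : ℕ} {U : Set (Fin n → ℝ)}

lemma IsMongeSystem.theta_trilinear (hC : C.IsMongeSystem φ) (x y z : Fin n → diffAlg m U) :
    ((φ * C.theta).map (algebraMap ℝ _) *ᵥ x) ⬝ᵥ (linMat C.psi z *ᵥ y) +
      ((φ * C.theta).map (algebraMap ℝ _) *ᵥ y) ⬝ᵥ (linMat C.psi x *ᵥ z) +
      ((φ * C.theta).map (algebraMap ℝ _) *ᵥ z) ⬝ᵥ (linMat C.psi y *ᵥ x) = 0 :=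
  evalAlg_ext fun q => by
    simp only [map_add, algHom_dotProduct, algHom_mulVec, algHom_constMat, algHom_linMat,
      map_zero]
    exact cyclic_trilinear hC.theta_cyclic _ _ _

lemma IsMongeSystem.xi_bilinear (hC : C.IsMongeSystem φ) (x y : Fin n → diffAlg m U) :
    (C.omega.map (algebraMap ℝ _) *ᵥ x) ⬝ᵥ ((φ * C.theta).map (algebraMap ℝ _) *ᵥ y) -
      (C.omega.map (algebraMap ℝ _) *ᵥ y) ⬝ᵥ ((φ * C.theta).map (algebraMap ℝ _) *ᵥ x) =
      (linMat C.psi y *ᵥ x) ⬝ᵥ (algebraMap ℝ _ ∘ (φ *ᵥ C.xi)) :=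
  evalAlg_ext fun q => by
    have hz : evalAlg q ∘ (algebraMap ℝ (diffAlg m U) ∘ (φ *ᵥ C.xi)) = φ *ᵥ C.xi :=
      funext fun i => (evalAlg q).commutes _
    simp only [map_sub, algHom_dotProduct, algHom_mulVec, algHom_constMat, algHom_linMat, hz]
    generalize evalAlg q ∘ x = x
    generalize evalAlg q ∘ y = y
    have h1 : ∀ x y : Fin n → ℝ, (C.omega *ᵥ x) ⬝ᵥ ((φ * C.theta) *ᵥ y) =
        ∑ j, ∑ l, x j * y l * (C.omegaᵀ * (φ * C.theta)) j l := by
      intro x y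
      rw [← Matrix.transpose_transpose C.omega, ← dotProduct_mulVec_comm, Matrix.mulVec_mulVec,
        Matrix.transpose_transpose]
      simp only [dotProduct, Matrix.mulVec, Finset.mul_sum]
      exact Finset.sum_congr rfl fun j _ => Finset.sum_congr rfl fun l _ => by ring
    have h2 : (linMat C.psi y *ᵥ x) ⬝ᵥ (φ *ᵥ C.xi) =
        ∑ j, ∑ l, x j * y l * ∑ γ, C.psi γ j l * (φ *ᵥ C.xi) γ := by
      generalize φ *ᵥ C.xi = z
      simp only [dotProduct, Matrix.mulVec, linMat, Matrix.of_apply, smul_eq_mul, Finset.sum_mul,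
        Finset.mul_sum]
      rw [Finset.sum_comm]
      refine Finset.sum_congr rfl fun j _ => ?_
      rw [Finset.sum_comm]
      exact Finset.sum_congr rfl fun l _ => Finset.sum_congr rfl fun γ _ => by ring
    have h3 : (C.omega *ᵥ y) ⬝ᵥ ((φ * C.theta) *ᵥ x) =
        ∑ j, ∑ l, y l * x j * (C.omegaᵀ * (φ * C.theta)) l j := by
      rw [h1, Finset.sum_comm]
    rw [h1 x y, h3, h2]
    simp only [← hC.xi_skew, ← Finset.sum_sub_distrib]
    exact Finset.sum_congr rfl fun j _ => Finset.sum_congr rfl fun l _ => by ring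

lemma mulVec_single_dotProduct {R : Type*} [CommRing R] (M : Matrix (Fin n) (Fin n) R)
    (s : Fin n → R) (j : Fin n) : (M *ᵥ Pi.single j 1) ⬝ᵥ s = (Mᵀ *ᵥ s) j := by
  rw [Matrix.mulVec_single_one]
  rfl

lemma d_comp_coordAlg (hU : IsOpen U) (k l : ℕ) (j : Fin n) :
    (jetAlg m hU).d k j ∘ coordAlg m U l = if l = k then Pi.single j 1 else 0 := by
  funext i
  rw [Function.comp_apply, d_coordAlg]
  by_cases h : l = k
  · simp [h, Pi.single_apply]
  · simp [h]

lemma D_comp_coordAlg (hU : IsOpen U) (l : ℕ) :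
    (jetAlg m hU).D ∘ coordAlg m U l = coordAlg m U (l + 1) :=
  funext fun i => D_coordAlg hU l i

lemma linMat_zero {R : Type*} [CommRing R] [Algebra ℝ R]
    (psi : Fin n → Matrix (Fin n) (Fin n) ℝ) : linMat psi (0 : Fin n → R) = 0 := by
  ext γ i
  simp [linMat]

/-- `energy` is six times the homotopy formula `∫₀¹ b · E(λb) dλ` for `E = ψᵀ (φ θ b + x φ ξ)`: its
four terms have degrees `3, 2, 2, 1` in the potentials, whence the coefficients `2, 3, 3, 6`. The
conditions `theta_cyclic` and `xi_skew` are what the formula needs to reproduce `E`. -/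
lemma IsMongeSystem.varDeriv_energy (hC : C.IsMongeSystem φ) (hU : IsOpen U) (j : Fin n) :
    (jetAlg m hU).varDeriv (C.energy φ (coordAlg m U 0) (coordAlg m U 1) (xAlg m U)) j =
      6 * ((affMat C.psi C.omega (coordAlg m U 1))ᵀ *ᵥ
        ((φ * C.theta).map (algebraMap ℝ _) *ᵥ coordAlg m U 0 +
          xAlg m U • (algebraMap ℝ _ ∘ (φ *ᵥ C.xi)))) j := by
  rw [(jetAlg m hU).varDeriv_eq_sum (K := 2)]
  · set e : Fin n → diffAlg m U := Pi.single j 1 with he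
    -- `h1` corrects the cubic terms. `h2` trades the antisymmetric part of `ωᵀ φ θ` against the `φ
    -- ξ` term without `x`, which appears because `D x = 1`.
    have h1 := hC.theta_trilinear (coordAlg m U 0) e (coordAlg m U 1)
    have h2 := hC.xi_bilinear e (coordAlg m U 0)
    have hs : ∀ X Y : Fin n → diffAlg m U, linMat C.psi X *ᵥ Y = -(linMat C.psi Y *ᵥ X) :=
      linMat_mulVec_skew hC.skew
    have h3 : (jetAlg m hU).D 2 = 0 := by simpa using ((jetAlg m hU).D).map_natCast 2
    have h4 : (jetAlg m hU).D 3 = 0 := by simpa using ((jetAlg m hU).D).map_natCast 3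
    have he0 : (jetAlg m hU).D ∘ e = 0 := funext fun i => by
      by_cases hi : i = j
      · subst hi
        simp [he]
      · simp [he, hi]
    rw [← mulVec_single_dotProduct, ← he, Finset.sum_range_succ, Finset.sum_range_one,
      derivation_energy, derivation_energy]
    simp only [d_comp_coordAlg, D_comp_coordAlg, d_xAlg, D_xAlg, one_ne_zero, zero_ne_one, if_true,
      if_false, ← he, Function.iterate_zero, Function.iterate_one, id, map_add, map_neg, map_zero,
      Derivation.leibniz, smul_eq_mul, derivation_dotProduct, derivation_mulVec, map_linMat,
      map_constMat, he0, h3, h4, Matrix.zero_mulVec, Matrix.mulVec_zero, zero_dotProduct,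
      dotProduct_zero, derivation_const_comp, linMat_zero, dotProduct_add, dotProduct_smul,
      affMat, Matrix.add_mulVec, add_dotProduct, hs e, neg_dotProduct]
    rw [hs (coordAlg m U 0) (coordAlg m U 1)] at h1
    rw [hs e] at h1
    simp only [dotProduct_neg] at h1
    rw [dotProduct_comm _ (linMat C.psi (coordAlg m U 1) *ᵥ e),
      dotProduct_comm _ (linMat C.psi (coordAlg m U 1) *ᵥ coordAlg m U 0),
      dotProduct_comm _ (linMat C.psi (coordAlg m U 0) *ᵥ e)] at h1
    linear_combination (-2 : diffAlg m U) * h1 - (3 : diffAlg m U) * h2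
  · intro k hk i
    rw [derivation_energy, d_comp_coordAlg, d_comp_coordAlg, if_neg (by omega), if_neg (by omega),
      d_xAlg]
    simp [linMat_zero]

/-- Monge systems are Hamiltonian. -/
theorem IsMongeSystem.isHamiltonianSystem (hC : C.IsMongeSystem φ) :
    IsHamiltonianSystem C.regular (C.monge φ) C.flux := by
  have hU := C.isOpen_regular
  set S := jetAlg 1 hU
  set H : diffAlg 1 C.regular := (-(1 / 6 : ℝ)) • C.energy φ (coordAlg 1 C.regular 0)
    (coordAlg 1 C.regular 1) (xAlg 1 C.regular) with hH
  set s : Fin n → diffAlg 1 C.regular := (φ * C.theta).map (algebraMap ℝ _) *ᵥ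
    coordAlg 1 C.regular 0 + xAlg 1 C.regular • (algebraMap ℝ _ ∘ (φ *ᵥ C.xi)) with hs
  have hvar : ∀ j, S.varDeriv H j = -((C.psiAlg 1)ᵀ *ᵥ s) j := by
    intro j
    have hsmul : S.varDeriv H j = (-(1 / 6 : ℝ)) • S.varDeriv (C.energy φ
        (coordAlg 1 C.regular 0) (coordAlg 1 C.regular 1) (xAlg 1 C.regular)) j := by
      obtain ⟨K, hK⟩ := S.exists_order (C.energy φ
        (coordAlg 1 C.regular 0) (coordAlg 1 C.regular 1) (xAlg 1 C.regular))
      have hit : ∀ (k : ℕ) (c : ℝ) g, S.D^[k] (c • g) = c • S.D^[k] g := by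
        intro k c g
        induction k with
        | zero => rfl
        | succ k ih => rw [Function.iterate_succ_apply', ih, Derivation.map_smul,
            Function.iterate_succ_apply']
      rw [S.varDeriv_eq_sum hK, S.varDeriv_eq_sum (K := K) fun k hk i => by
        rw [hH, Derivation.map_smul, hK k hk, smul_zero]]
      simp only [hH, Derivation.map_smul, hit, Finset.smul_sum, mul_smul_comm]
    rw [hsmul, hC.varDeriv_energy]
    have h6 : (6 : diffAlg 1 C.regular) = algebraMap ℝ _ 6 :=
      (map_ofNat (algebraMap ℝ (diffAlg 1 C.regular)) 6).symm
    rw [h6, ← Algebra.smul_def, smul_smul,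
      show (-(1 / 6) * 6 : ℝ) = -1 by norm_num, neg_one_smul]
  have hπ : ∀ j, IsDiffFun (cylinder 1 C.regular) (fun r => -varD j (lift H) r) := fun j =>
    ((isDiffFun_const (-1)).mul (isDiffFun_varD hU (isDiffFun_lift H) j)).congr
      fun q _ => (neg_one_mul _).symm
  have hleft : (C.psiAlg 1)ᵀ *ᵥ s = fun j => toAlg _ (hπ j) := by
    funext j
    refine evalAlg_ext fun q => ?_
    rw [evalAlg_toAlg, ← varDeriv_toAlg_apply hU (isDiffFun_lift H), toAlg_lift]
    change _ = -evalAlg q (S.varDeriv H j)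
    rw [hvar, map_neg, neg_neg]
  -- `D b = u` and `D x = 1`, so `φ⁻¹ D s` is `Z = θ u + ξ`, and the last stage `ψ⁻¹ Z` is the flux.
  have hDs : S.D ∘ s = φ.map (algebraMap ℝ _) *ᵥ (C.theta.map (algebraMap ℝ _) *ᵥ
      coordAlg 1 C.regular 1 + algebraMap ℝ _ ∘ C.xi) := by
    have h1 : S.D ∘ s = S.D ∘ ((φ * C.theta).map (algebraMap ℝ _) *ᵥ coordAlg 1 C.regular 0) +
        algebraMap ℝ _ ∘ (φ *ᵥ C.xi) := by
      funext i
      simp [hs, S, D_xAlg]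
    rw [h1, derivation_mulVec, map_constMat, Matrix.zero_mulVec, zero_add, D_comp_coordAlg,
      Matrix.mulVec_add, Matrix.mulVec_mulVec, Matrix.map_mul]
    congr 1
    funext i
    simp [Matrix.mulVec, dotProduct]
  have hunit := isUnit_det_psiAlg (C := C) (m := 1)
  obtain ⟨b, hb⟩ : ∃ b, C.psiAlg 1 *ᵥ b = φ⁻¹.map (algebraMap ℝ _) *ᵥ (S.D ∘ s) :=
    ⟨(C.psiAlg 1)⁻¹ *ᵥ _, by
      rw [Matrix.mulVec_mulVec, Matrix.mul_nonsing_inv _ hunit, Matrix.one_mulVec]⟩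
  have hb1 := hb
  rw [hDs, Matrix.mulVec_mulVec, ← Matrix.map_mul,
    Matrix.nonsing_inv_mul _ (isUnit_iff_ne_zero.2 hC.det_ne_zero),
    Matrix.map_one _ (map_zero _) (map_one _), Matrix.one_mulVec] at hb1
  have hflux : ∀ (q : cylinder 1 C.regular) i, C.flux (q.1.2 1) i = evalAlg q (b i) := by
    intro q i
    have hb' := congrArg (evalAlg q ∘ ·) hb1
    have h2 : evalAlg q ∘ (C.theta.map (algebraMap ℝ _) *ᵥ coordAlg 1 C.regular 1 +
        algebraMap ℝ _ ∘ C.xi) = C.theta *ᵥ q.1.2 1 + C.xi := by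
      have h3 : evalAlg q ∘ (C.theta.map (algebraMap ℝ _) *ᵥ coordAlg 1 C.regular 1) =
          C.theta *ᵥ q.1.2 1 := by
        rw [algHom_mulVec, algHom_constMat]
        rfl
      rw [← h3]
      funext i
      simp
    simp only [h2, algHom_mulVec, map_psiAlg] at hb'
    rw [flux, ← hb', Matrix.mulVec_mulVec,
      Matrix.nonsing_inv_mul _ (isUnit_iff_ne_zero.2 q.2), Matrix.one_mulVec]
    rfl
  -- Both sides are total derivatives of functions that agree on the cylinder with the last stage `b
  -- i`.
  refine ⟨lift H, isDiffFun_lift H, fun q hq i => ?_⟩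
  refine ((isField_totalD hU).congr (isDiffFun_lift (b i)) (fun r hr => ?_) q hq).trans
    ((isField_totalD hU).congr (isDiffFun_lift (b i)) (fun r hr => ?_) q hq).symm
  · rw [lift_apply _ ⟨r, hr⟩]
    exact hflux ⟨r, hr⟩ i
  · rw [lift_apply _ ⟨r, hr⟩]
    exact innerOp_monge hC.toIsMonge hπ hleft hb ⟨r, hr⟩ i

end LineCongruence

end

/-! ### Algebra of the WDVV equations: the congruence, the Monge conditions, and reduction to one
equation. -/

section

namespace LineCongruence

variable {n : ℕ} {C : LineCongruence n}

lemma swap_holds_iff {u v : Fin n → ℝ} : C.swap.Holds u v ↔ C.Holds v u := by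
  refine forall_congr' fun γ => ?_
  have h : ∑ k, ∑ m, C.psi γ k m * (u m * v k - u k * v m) =
      -∑ k, ∑ m, C.psi γ k m * (v m * u k - v k * u m) := by
    simp only [← Finset.sum_neg_distrib]
    exact Finset.sum_congr rfl fun k _ => Finset.sum_congr rfl fun m _ => by ring
  simp only [swap, h, Pi.neg_apply]
  constructor <;> intro h' <;> linarith

/-- Skewness of `ψ` makes the two halves of the Plücker sum equal, which absorbs the factor `1/2`.
-/
lemma holds_iff_psiMat_mulVec (hC : ∀ γ i k, C.psi γ k i = -C.psi γ i k) {u v : Fin n → ℝ} :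
    C.Holds u v ↔ C.psiMat u *ᵥ v = C.theta *ᵥ u + C.xi := by
  rw [funext_iff]
  refine forall_congr' fun γ => ?_
  have h1 : ∑ k, ∑ m, C.psi γ k m * (u m * v k - u k * v m) =
      2 * ∑ k, ∑ m, C.psi γ k m * u m * v k := by
    have h2 : ∑ k, ∑ m, C.psi γ k m * u k * v m = -∑ k, ∑ m, C.psi γ k m * u m * v k := by
      rw [Finset.sum_comm]
      simp only [← Finset.sum_neg_distrib]
      refine Finset.sum_congr rfl fun k _ => Finset.sum_congr rfl fun m _ => ?_
      rw [hC γ k m]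
      ring
    simp only [mul_sub, Finset.sum_sub_distrib, ← mul_assoc, h2]
    ring
  rw [h1]
  simp only [psiMat, Matrix.mulVec, dotProduct, Matrix.of_apply, Pi.add_apply, add_mul,
    Finset.sum_add_distrib, Finset.sum_mul]
  constructor <;> intro h <;> linarith

lemma holds_iff_eq_flux (hC : ∀ γ i k, C.psi γ k i = -C.psi γ i k) {u : Fin n → ℝ}
    (hu : u ∈ C.regular) (v : Fin n → ℝ) : C.Holds u v ↔ v = C.flux u := by
  have hA : IsUnit (C.psiMat u).det := isUnit_iff_ne_zero.2 hu
  rw [holds_iff_psiMat_mulVec hC, flux]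
  constructor
  · intro h
    rw [← h, Matrix.mulVec_mulVec, Matrix.nonsing_inv_mul _ hA, Matrix.one_mulVec]
  · intro h
    rw [h, Matrix.mulVec_mulVec, Matrix.mul_nonsing_inv _ hA, Matrix.one_mulVec]

end LineCongruence

/-- A nonzero linear functional is an open map, and preimages of dense sets under open maps are
dense. -/
lemma dense_affine_ne_zero {n : ℕ} (a : Fin n → ℝ) (c : ℝ) (h : a ≠ 0 ∨ c ≠ 0) :
    Dense {u : Fin n → ℝ | a ⬝ᵥ u + c ≠ 0} := by
  by_cases ha : a = 0
  · simp [ha, h.resolve_left (by simpa using ha)]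
  obtain ⟨i, hi⟩ := Function.ne_iff.1 ha
  have hs : Function.Surjective (dotProductBilin ℝ ℝ a) := fun y =>
    ⟨Pi.single i (y / a i), by
      simp only [dotProductBilin_apply_apply, dotProduct_single]
      exact mul_div_cancel₀ y hi⟩
  have hd : Dense {y : ℝ | y ≠ -c} := dense_compl_singleton (-c)
  refine (hd.preimage ((dotProductBilin ℝ ℝ a).isOpenMap_of_finiteDimensional hs)).mono ?_
  intro u hu h0
  exact hu (eq_neg_of_add_eq_zero_left h0)

variable {η : Matrix (Fin 3) (Fin 3) ℝ}

/-- A nondegenerate symmetric `3 × 3` matrix in terms of the entries of its inverse. -/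
lemma exists_inv_entries (hsymm : η.IsSymm) (hdet : η.det ≠ 0) :
    ∃ a b c d e f D : ℝ, D ≠ 0 ∧ D = a * (d * f - e * e) - b * (b * f - c * e) +
      c * (b * e - c * d) ∧ η⁻¹ = !![a, b, c; b, d, e; c, e, f] ∧
      η = D⁻¹ • !![d * f - e * e, c * e - b * f, b * e - c * d;
        c * e - b * f, a * f - c * c, b * c - a * e;
        b * e - c * d, b * c - a * e, a * d - b * b] := by
  have hs : ∀ i j, η⁻¹ i j = η⁻¹ j i := fun i j => by
    have h : (η⁻¹)ᵀ = η⁻¹ := by rw [Matrix.transpose_nonsing_inv, hsymm.eq]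
    exact congrFun (congrFun h j) i
  have h1 : η⁻¹ = !![η⁻¹ 0 0, η⁻¹ 0 1, η⁻¹ 0 2; η⁻¹ 0 1, η⁻¹ 1 1, η⁻¹ 1 2;
      η⁻¹ 0 2, η⁻¹ 1 2, η⁻¹ 2 2] := by
    ext i j
    fin_cases i <;> fin_cases j <;> first | rfl | exact hs _ _
  have hd : η⁻¹.det ≠ 0 := by
    rw [Matrix.det_nonsing_inv, Ring.inverse_eq_inv']
    exact inv_ne_zero hdet
  have h2 := Matrix.nonsing_inv_nonsing_inv η (isUnit_iff_ne_zero.2 hdet)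
  refine ⟨_, _, _, _, _, _, η⁻¹.det, hd, ?_, h1, ?_⟩
  · rw [Matrix.det_fin_three, hs 1 0, hs 2 0, hs 2 1]
    ring
  · have h3 : η = η⁻¹.det⁻¹ • η⁻¹.adjugate := by
      conv_lhs => rw [← h2, Matrix.inv_def (η⁻¹), Ring.inverse_eq_inv']
    refine h3.trans ?_
    rw [Matrix.adjugate_fin_three]
    congr 1
    ext i j
    fin_cases i <;> fin_cases j <;> simp [hs 1 0, hs 2 0, hs 2 1] <;> ring

/-- `phi η` is the second compound matrix of `η⁻¹`: its entries are the `2 × 2` minors for the index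
pairs `12, 13, 23`. Its determinant is therefore `det(η⁻¹) ^ 2`. -/
lemma det_phi_ne_zero (hsymm : η.IsSymm) (hdet : η.det ≠ 0) : (phi η).det ≠ 0 := by
  obtain ⟨a, b, c, d, e, f, D, hD, hDeq, hinv, -⟩ := exists_inv_entries hsymm hdet
  have h : (phi η).det = D ^ 2 := by
    rw [Matrix.det_fin_three, hDeq]
    simp [phi, hinv]
    ring
  rw [h]
  exact pow_ne_zero 2 hD

lemma psi_wdvvCongruence_skew (η : Matrix (Fin 3) (Fin 3) ℝ) (γ i k : Fin 3) :
    (wdvvCongruence η).psi γ k i = -(wdvvCongruence η).psi γ i k := by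
  fin_cases γ <;> fin_cases i <;> fin_cases k <;> simp [wdvvCongruence]

/-- The cyclic sum is totally antisymmetric in `i, j, k`, so in dimension three it has a single
independent component. -/
lemma cyclic_fin_three {A : Matrix (Fin 3) (Fin 3) ℝ} (hA : ∀ i k, A k i = -A i k)
    {c : Fin 3 → ℝ} (h : c 0 * A 1 2 + c 1 * A 2 0 + c 2 * A 0 1 = 0) (i j k : Fin 3) :
    c i * A j k + c j * A k i + c k * A i j = 0 := by
  have h0 : ∀ i, A i i = 0 := fun i => by linarith [hA i i]
  have h1 := hA 0 1
  have h2 := hA 1 2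
  have h3 := hA 2 0
  fin_cases i <;> fin_cases j <;> fin_cases k <;>
    simp only [Fin.zero_eta, Fin.mk_one, Fin.reduceFinMk, h0, h1, h2, h3] <;>
    linarith

/-- Only the last matrix `psi 2` is nonzero, so the cyclic conditions reduce to one scalar equation
on the last row of `N`. -/
lemma wdvv_cyclic {N : Matrix (Fin 3) (Fin 3) ℝ}
    (h : N 2 0 * η⁻¹ 2 2 - N 2 1 * η⁻¹ 1 2 + N 2 2 * η⁻¹ 1 1 = 0) (i j k : Fin 3) :
    ∑ γ, N γ i * (wdvvCongruence η).psi γ j k + ∑ γ, N γ j * (wdvvCongruence η).psi γ k i +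
      ∑ γ, N γ k * (wdvvCongruence η).psi γ i j = 0 := by
  have hsum : ∀ i j k, ∑ γ, N γ i * (wdvvCongruence η).psi γ j k =
      N 2 i * (wdvvCongruence η).psi 2 j k := by
    intro i j k
    simp [Fin.sum_univ_three, wdvvCongruence]
  rw [hsum, hsum, hsum]
  refine cyclic_fin_three (c := N 2) (fun i k => psi_wdvvCongruence_skew η 2 i k) ?_ i j k
  simp only [wdvvCongruence, Matrix.cons_val, Matrix.of_apply]
  linear_combination -h

lemma phi_transpose (η : Matrix (Fin 3) (Fin 3) ℝ) : (phi η)ᵀ = phi η := by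
  ext i j
  fin_cases i <;> fin_cases j <;> rfl

/-- The congruence and its swap share `ψ` and `φ`, and `ψ(0) = ω`; so `theta_cyclic` for either one
is the Monge identity of the other at `u = 0`. As `φ` is symmetric, `xi_skew` for the swap is the
transposed condition. Two scalar cyclic identities and the three components of `xi_skew` remain,
polynomial in the entries of `η⁻¹` once `η` is written by cofactors. -/
lemma isMongeSystem_wdvv (hsymm : η.IsSymm) (hdet : η.det ≠ 0) :
    (wdvvCongruence η).IsMongeSystem (phi η) ∧ (wdvvCongruence η).swap.IsMongeSystem (phi η) := by
  have hphi := det_phi_ne_zero hsymm hdet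
  obtain ⟨a, b, c, d, e, f, D, hD, hDeq, hinv, hη⟩ := exists_inv_entries hsymm hdet
  have he : ∀ i j, η i j = (D⁻¹ • !![d * f - e * e, c * e - b * f, b * e - c * d;
        c * e - b * f, a * f - c * c, b * c - a * e;
        b * e - c * d, b * c - a * e, a * d - b * b] : Matrix (Fin 3) (Fin 3) ℝ) i j :=
    fun i j => congrFun (congrFun hη i) j
  have hω : ∀ u i j k, ∑ γ, (phi η * (wdvvCongruence η).psiMat u) γ i *
      (wdvvCongruence η).psi γ j k + ∑ γ, (phi η * (wdvvCongruence η).psiMat u) γ j *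
      (wdvvCongruence η).psi γ k i + ∑ γ, (phi η * (wdvvCongruence η).psiMat u) γ k *
      (wdvvCongruence η).psi γ i j = 0 := by
    intro u
    refine wdvv_cyclic ?_
    simp [Matrix.mul_apply, Fin.sum_univ_three, phi, LineCongruence.psiMat, wdvvCongruence, hinv,
      he]
    field_simp
    rw [hDeq]
    ring
  have hθ : ∀ u i j k, ∑ γ, (phi η * (wdvvCongruence η).swap.psiMat u) γ i *
      (wdvvCongruence η).psi γ j k + ∑ γ, (phi η * (wdvvCongruence η).swap.psiMat u) γ j *
      (wdvvCongruence η).psi γ k i + ∑ γ, (phi η * (wdvvCongruence η).swap.psiMat u) γ k *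
      (wdvvCongruence η).psi γ i j = 0 := by
    intro u
    refine wdvv_cyclic ?_
    simp [Matrix.mul_apply, Fin.sum_univ_three, phi, LineCongruence.psiMat, wdvvCongruence, hinv,
      he, LineCongruence.swap]
    field_simp
    rw [hDeq]
    ring
  have h0 : ∀ C : LineCongruence 3, C.psiMat 0 = C.omega := fun C => by
    ext
    simp [LineCongruence.psiMat]
  have hξ : ∀ j l, ((wdvvCongruence η).omegaᵀ * (phi η * (wdvvCongruence η).theta)) j l -
      ((wdvvCongruence η).omegaᵀ * (phi η * (wdvvCongruence η).theta)) l j =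
      ∑ γ, (wdvvCongruence η).psi γ j l * (phi η *ᵥ (wdvvCongruence η).xi) γ := by
    have hx : ∀ j l, ∑ γ, (wdvvCongruence η).psi γ j l * (phi η *ᵥ (wdvvCongruence η).xi) γ =
        (wdvvCongruence η).psi 2 j l * (phi η *ᵥ (wdvvCongruence η).xi) 2 := fun j l => by
      simp [Fin.sum_univ_three, wdvvCongruence]
    have h01 : ((wdvvCongruence η).omegaᵀ * (phi η * (wdvvCongruence η).theta)) 0 1 -
        ((wdvvCongruence η).omegaᵀ * (phi η * (wdvvCongruence η).theta)) 1 0 =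
        (wdvvCongruence η).psi 2 0 1 * (phi η *ᵥ (wdvvCongruence η).xi) 2 := by
      simp [Matrix.mul_apply, Matrix.mulVec, dotProduct, Fin.sum_univ_three, phi, wdvvCongruence,
        hinv, he]
      field_simp
      rw [hDeq]
      ring
    have h02 : ((wdvvCongruence η).omegaᵀ * (phi η * (wdvvCongruence η).theta)) 0 2 -
        ((wdvvCongruence η).omegaᵀ * (phi η * (wdvvCongruence η).theta)) 2 0 =
        (wdvvCongruence η).psi 2 0 2 * (phi η *ᵥ (wdvvCongruence η).xi) 2 := by
      simp [Matrix.mul_apply, Matrix.mulVec, dotProduct, Fin.sum_univ_three, phi, wdvvCongruence,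
        hinv, he]
      field_simp
      rw [hDeq]
      ring
    have h12 : ((wdvvCongruence η).omegaᵀ * (phi η * (wdvvCongruence η).theta)) 1 2 -
        ((wdvvCongruence η).omegaᵀ * (phi η * (wdvvCongruence η).theta)) 2 1 =
        (wdvvCongruence η).psi 2 1 2 * (phi η *ᵥ (wdvvCongruence η).xi) 2 := by
      simp [Matrix.mul_apply, Matrix.mulVec, dotProduct, Fin.sum_univ_three, phi, wdvvCongruence,
        hinv, he]
      field_simp
      rw [hDeq]
      ring
    have hsk := psi_wdvvCongruence_skew η 2
    have hd : ∀ i, (wdvvCongruence η).psi 2 i i = 0 := fun i => by linarith [hsk i i]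
    intro j l
    rw [hx]
    fin_cases j <;> fin_cases l <;>
      simp only [Fin.zero_eta, Fin.mk_one, Fin.reduceFinMk, sub_self, hd, zero_mul, h01, h02, h12,
        hsk 0 1, hsk 0 2, hsk 1 2] <;> linarith
  refine ⟨⟨⟨phi_transpose η, hphi, psi_wdvvCongruence_skew η, hω⟩, ?_, hξ⟩,
    ⟨⟨phi_transpose η, hphi, psi_wdvvCongruence_skew η, hθ⟩, ?_, fun j l => ?_⟩⟩
  · have h := hθ 0
    rwa [h0] at h
  · have h := hω 0
    rwa [h0] at h
  · have ht : (wdvvCongruence η).thetaᵀ * (phi η * (wdvvCongruence η).omega) =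
        ((wdvvCongruence η).omegaᵀ * (phi η * (wdvvCongruence η).theta))ᵀ := by
      rw [Matrix.transpose_mul, Matrix.transpose_mul, Matrix.transpose_transpose, phi_transpose,
        Matrix.mul_assoc]
    have h := hξ j l
    simp only [LineCongruence.swap, ht, Matrix.transpose_apply, Matrix.mulVec_neg, Pi.neg_apply,
      mul_neg, Finset.sum_neg_distrib]
    linarith

lemma det_psiMat_wdvv (η : Matrix (Fin 3) (Fin 3) ℝ) (u : Fin 3 → ℝ) :
    ((wdvvCongruence η).psiMat u).det =
      ![η⁻¹ 1 2, η⁻¹ 2 2, 0] ⬝ᵥ u + η⁻¹ 0 2 * η 1 1 := by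
  rw [Matrix.det_fin_three]
  simp [LineCongruence.psiMat, wdvvCongruence, Fin.sum_univ_three, dotProduct]

lemma det_psiMat_wdvv_swap (η : Matrix (Fin 3) (Fin 3) ℝ) (u : Fin 3 → ℝ) :
    ((wdvvCongruence η).swap.psiMat u).det =
      ![0, -η⁻¹ 1 1, -η⁻¹ 1 2] ⬝ᵥ u + -(η⁻¹ 0 1 * η 2 2) := by
  rw [Matrix.det_fin_three]
  simp [LineCongruence.psiMat, LineCongruence.swap, wdvvCongruence, Fin.sum_univ_three, dotProduct]

/-- `det ψ` is affine in `u`. If its linear part vanishes, then for `p = 1` one gets `e = f = 0`, `D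
= -c²d` and constant term `-c³/D`; otherwise `d = e = 0`, `D = -b²f` and constant term `b³/D`. Both
are nonzero because `D` is. -/
lemma dense_regular (hsymm : η.IsSymm) (hdet : η.det ≠ 0) (p : Fin 3) :
    Dense (chosenCongruence η p).regular := by
  obtain ⟨a, b, c, d, e, f, D, hD, hDeq, hinv, hη⟩ := exists_inv_entries hsymm hdet
  unfold chosenCongruence LineCongruence.regular
  split_ifs
  · simp only [det_psiMat_wdvv]
    refine dense_affine_ne_zero _ _ (or_iff_not_imp_left.2 fun h => ?_)
    rw [not_not] at h
    have h0 := congrFun h 0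
    have h1 := congrFun h 1
    have h2 : η 1 1 = D⁻¹ * (a * f - c * c) := by rw [hη]; simp
    rw [h2]
    simp [hinv] at h0 h1 ⊢
    subst h0 h1
    have hc : c ≠ 0 := by
      rintro rfl
      exact hD (by rw [hDeq]; ring)
    simp [hc, hD]
  · simp only [det_psiMat_wdvv_swap]
    refine dense_affine_ne_zero _ _ (or_iff_not_imp_left.2 fun h => ?_)
    rw [not_not] at h
    have h0 := congrFun h 1
    have h1 := congrFun h 2
    have h2 : η 2 2 = D⁻¹ * (a * d - b * b) := by rw [hη]; simp
    rw [h2]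
    simp [hinv] at h0 h1 ⊢
    subst h0 h1
    have hb : b ≠ 0 := by
      rintro rfl
      exact hD (by rw [hDeq]; ring)
    simp [hb, hD]

/-- A component without an index `0` is nonzero only if each antisymmetric pair is `{1, 2}`, and is
then `± S 1 1 2 2`. -/
lemma skew_tensor_eq_zero {S : Fin 3 → Fin 3 → Fin 3 → Fin 3 → ℝ}
    (anti₁ : ∀ α β γ ν, S γ β α ν = -S α β γ ν) (anti₂ : ∀ α β γ ν, S α ν γ β = -S α β γ ν)
    (first : ∀ β γ ν, S 0 β γ ν = 0) (second : ∀ α γ ν, S α 0 γ ν = 0) (h : S 1 1 2 2 = 0)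
    (α β γ ν : Fin 3) : S α β γ ν = 0 := by
  have third : ∀ α β ν, S α β 0 ν = 0 := fun α β ν => by rw [anti₁, first, neg_zero]
  have fourth : ∀ α β γ, S α β γ 0 = 0 := fun α β γ => by rw [anti₂, second, neg_zero]
  have diag₁ : ∀ α β ν, S α β α ν = 0 := fun α β ν => by linarith [anti₁ α β α ν]
  have diag₂ : ∀ α β γ, S α β γ β = 0 := fun α β γ => by linarith [anti₂ α β γ β]
  have h1 : S 2 1 1 2 = 0 := by rw [anti₁, h, neg_zero]
  have h2 : S 1 2 2 1 = 0 := by rw [anti₂, h, neg_zero]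
  have h3 : S 2 2 1 1 = 0 := by rw [anti₂, h1, neg_zero]
  have cases : ∀ i : Fin 3, i = 0 ∨ i = 1 ∨ i = 2 := by decide
  rcases cases α with rfl | rfl | rfl
  · exact first _ _ _
  all_goals
    rcases cases γ with rfl | rfl | rfl
    · exact third _ _ _
    all_goals
      rcases cases β with rfl | rfl | rfl
      · exact second _ _ _
      all_goals
        rcases cases ν with rfl | rfl | rfl
        · exact fourth _ _ _
        all_goals first | assumption | exact diag₁ _ _ _ | exact diag₂ _ _ _

/-- For symmetric tensors, the WDVV equations are equivalent to the linear line congruence. -/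
lemma wdvv_tensor_iff (hsymm : η.IsSymm) (hdet : η.det ≠ 0) {T : Fin 3 → Fin 3 → Fin 3 → ℝ}
    (h12 : ∀ a b c, T a b c = T b a c) (h23 : ∀ a b c, T a b c = T a c b)
    (h0 : ∀ a b, T 0 a b = η a b) :
    (∀ α β γ ν, ∑ l, ∑ m, η⁻¹ l m * (T l α β * T m γ ν - T l α ν * T m γ β) = 0) ↔
      (wdvvCongruence η).Holds ![T 1 1 1, T 1 1 2, T 1 2 2] ![T 2 1 1, T 2 1 2, T 2 2 2] := by
  set S : Fin 3 → Fin 3 → Fin 3 → Fin 3 → ℝ := fun α β γ ν =>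
    ∑ l, ∑ m, η⁻¹ l m * (T l α β * T m γ ν - T l α ν * T m γ β) with hS
  have hs : ∀ i j, η⁻¹ i j = η⁻¹ j i := fun i j => by
    have h : (η⁻¹)ᵀ = η⁻¹ := by rw [Matrix.transpose_nonsing_inv, hsymm.eq]
    exact congrFun (congrFun h j) i
  have hη : ∀ i j, η i j = η j i := fun i j => (hsymm.apply i j).symm
  have anti₁ : ∀ α β γ ν, S γ β α ν = -S α β γ ν := by
    intro α β γ ν
    simp only [hS, ← Finset.sum_neg_distrib]
    rw [Finset.sum_comm]
    exact Finset.sum_congr rfl fun l _ => Finset.sum_congr rfl fun m _ => by rw [hs]; ring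
  have anti₂ : ∀ α β γ ν, S α ν γ β = -S α β γ ν := by
    intro α β γ ν
    simp only [hS, ← Finset.sum_neg_distrib]
    exact Finset.sum_congr rfl fun l _ => Finset.sum_congr rfl fun m _ => by ring
  have hinv : ∀ i (w : Fin 3 → ℝ), ∑ l, ∑ m, η⁻¹ l m * (η l i * w m) = w i := by
    intro i w
    have h : η *ᵥ (η⁻¹ *ᵥ w) = w := by
      rw [Matrix.mulVec_mulVec, Matrix.mul_nonsing_inv _ (isUnit_iff_ne_zero.2 hdet),
        Matrix.one_mulVec]
    rw [← congrFun h i]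
    simp only [Matrix.mulVec, dotProduct, Finset.mul_sum]
    exact Finset.sum_congr rfl fun l _ => Finset.sum_congr rfl fun m _ => by rw [hη i l]; ring
  have hinv' : ∀ i (w : Fin 3 → ℝ), ∑ l, ∑ m, η⁻¹ l m * (w l * η m i) = w i := by
    intro i w
    rw [← hinv i w, Finset.sum_comm]
    exact Finset.sum_congr rfl fun l _ => Finset.sum_congr rfl fun m _ => by rw [hs]; ring
  -- For `α = 0` the factors `T l 0 ·` are entries of `η` and cancel `η⁻¹`, leaving `T β γ ν - T ν γ
  -- β = 0`.
  have first : ∀ β γ ν, S 0 β γ ν = 0 := by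
    intro β γ ν
    simp only [hS, mul_sub, Finset.sum_sub_distrib, h12 _ 0, h0, hinv]
    rw [h23 β, h12 β, h23 ν, h23 ν, h23 ν, h12 ν, h23 γ, sub_self]
  have second : ∀ α γ ν, S α 0 γ ν = 0 := by
    intro α γ ν
    simp only [hS, mul_sub, Finset.sum_sub_distrib, h23 _ _ 0, h12 _ 0, h0, hinv, hinv']
    rw [h12, sub_self]
  have e1 : T 2 1 1 = T 1 1 2 := by rw [h12, h23]
  have e2 : T 2 1 2 = T 1 2 2 := h12 _ _ _
  have key : (∀ α β γ ν, S α β γ ν = 0) ↔ S 1 1 2 2 = 0 :=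
    ⟨fun h => h _ _ _ _, skew_tensor_eq_zero anti₁ anti₂ first second⟩
  refine key.trans ?_
  have t0 : T 0 1 1 = η 1 1 := h0 _ _
  have t1 : T 0 1 2 = η 1 2 := h0 _ _
  have t2 : T 0 2 2 = η 2 2 := h0 _ _
  have t3 : T 0 2 1 = η 1 2 := by rw [h23, t1]
  have hS1 : S 1 1 2 2 = η⁻¹ 0 0 * (η 1 1 * η 2 2 - η 1 2 ^ 2) +
      η⁻¹ 0 1 * (η 1 1 * T 1 2 2 + T 1 1 1 * η 2 2 - 2 * η 1 2 * T 1 1 2) +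
      η⁻¹ 0 2 * (η 1 1 * T 2 2 2 + T 1 1 2 * η 2 2 - 2 * η 1 2 * T 1 2 2) +
      η⁻¹ 1 1 * (T 1 1 1 * T 1 2 2 - T 1 1 2 ^ 2) +
      η⁻¹ 1 2 * (T 1 1 1 * T 2 2 2 - T 1 1 2 * T 1 2 2) +
      η⁻¹ 2 2 * (T 1 1 2 * T 2 2 2 - T 1 2 2 ^ 2) := by
    have e3 : T 1 2 1 = T 1 1 2 := h23 _ _ _
    have e4 : T 2 2 1 = T 1 2 2 := by rw [h23, e2]
    simp only [hS, Fin.sum_univ_three, t0, t1, t2, t3, e1, e2, e3, e4, hs 1 0, hs 2 0, hs 2 1]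
    ring
  -- The first two equations of the congruence hold by symmetry of `T`; the third is `S 1 1 2 2 =
  -- 0`.
  constructor
  · intro h γ
    rw [hS1] at h
    fin_cases γ
    · simp [wdvvCongruence, Fin.sum_univ_three, e1]
    · simp [wdvvCongruence, Fin.sum_univ_three, e2]
    · simp [wdvvCongruence, Fin.sum_univ_three, e1, e2]
      linear_combination h
  · intro h
    have h2 := h 2
    simp [wdvvCongruence, Fin.sum_univ_three, e1, e2] at h2
    rw [hS1]
    linear_combination h2

end

/-! ### Passing between solutions of the WDVV system and of the conservation laws. -/

section

section Calculus

variable {W : Set (Fin 3 → ℝ)} {G G' : (Fin 3 → ℝ) → ℝ}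

lemma ContDiffOn.pderiv (hW : IsOpen W) {k l : WithTop ℕ∞} (hG : ContDiffOn ℝ l G W)
    (hk : k + 1 ≤ l) (a : Fin 3) : ContDiffOn ℝ k (WDVV.pderiv a G) W :=
  (hG.fderiv_of_isOpen hW hk).clm_apply contDiffOn_const

lemma pderiv_congr (hW : IsOpen W) (h : ∀ t ∈ W, G t = G' t) (a : Fin 3) :
    ∀ t ∈ W, pderiv a G t = pderiv a G' t := by
  intro t ht
  have he : G =ᶠ[nhds t] G' := Filter.eventually_of_mem (hW.mem_nhds ht) h
  rw [pderiv, pderiv, he.fderiv_eq]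

lemma pderiv_comm (hW : IsOpen W) (hG : ContDiffOn ℝ 2 G W) (a b : Fin 3) :
    ∀ t ∈ W, pderiv a (pderiv b G) t = pderiv b (pderiv a G) t := by
  intro t ht
  have hd : DifferentiableAt ℝ (fderiv ℝ G) t :=
    ((hG.fderiv_of_isOpen hW (m := 1) (by norm_num [one_add_one_eq_two])).contDiffAt
      (hW.mem_nhds ht)).differentiableAt (by simp)
  have hs : ∀ c d : Fin 3, pderiv c (pderiv d G) t =
      fderiv ℝ (fderiv ℝ G) t (Pi.single c 1) (Pi.single d 1) := by
    intro c d
    change fderiv ℝ (fun s => fderiv ℝ G s (Pi.single d 1)) t _ = _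
    rw [fderiv_clm_apply hd (differentiableAt_const _)]
    simp
  rw [hs, hs]
  exact (hG.contDiffAt (hW.mem_nhds ht)).isSymmSndFDerivAt (by simp) _ _

lemma fderiv_apply_eq_sum_pderiv (G : (Fin 3 → ℝ) → ℝ) (t x : Fin 3 → ℝ) :
    fderiv ℝ G t x = ∑ a, x a * pderiv a G t := by
  conv_lhs => rw [← Finset.univ_sum_single x, map_sum]
  refine Finset.sum_congr rfl fun a _ => ?_
  rw [pderiv, ← smul_eq_mul, ← map_smul, ← Pi.single_smul, smul_eq_mul, mul_one]

/-- The Poincaré lemma for `1`-forms on convex open sets. -/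
lemma exists_potential (hW : IsOpen W) (hconv : Convex ℝ W) {k : ℕ} (hk : k ≠ 0)
    {ω : Fin 3 → (Fin 3 → ℝ) → ℝ} (hω : ∀ a, ContDiffOn ℝ k (ω a) W)
    (hclosed : ∀ t ∈ W, ∀ a b, pderiv a (ω b) t = pderiv b (ω a) t) :
    ∃ f, ContDiffOn ℝ (k + 1 : ℕ) f W ∧ ∀ t ∈ W, ∀ a, pderiv a f t = ω a t := by
  set form : (Fin 3 → ℝ) → ((Fin 3 → ℝ) →L[ℝ] ℝ) := fun t =>
    ∑ a, ω a t • ContinuousLinearMap.proj (R := ℝ) (φ := fun _ : Fin 3 => ℝ) a with hform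
  have hk' : (k : WithTop ℕ∞) ≠ 0 := by exact_mod_cast hk
  have hsmooth : ContDiffOn ℝ k form W :=
    ContDiffOn.sum fun a _ => (hω a).smul contDiffOn_const
  have hd : ∀ t ∈ W, ∀ a, DifferentiableAt ℝ (ω a) t := fun t ht a =>
    ((hω a).contDiffAt (hW.mem_nhds ht)).differentiableAt hk'
  have hfd : ∀ t ∈ W, ∀ x y, fderiv ℝ form t x y = ∑ a, ∑ b, x b * y a * pderiv b (ω a) t := by
    intro t ht x y
    have h := HasFDerivAt.fun_sum (u := Finset.univ) fun a _ =>
      (hd t ht a).hasFDerivAt.smul_const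
        (ContinuousLinearMap.proj (R := ℝ) (φ := fun _ : Fin 3 => ℝ) a)
    rw [hform, h.fderiv]
    simp only [_root_.sum_apply, ContinuousLinearMap.smulRight_apply, _root_.smul_apply,
      ContinuousLinearMap.proj_apply, smul_eq_mul, fderiv_apply_eq_sum_pderiv, Finset.sum_mul]
    exact Finset.sum_congr rfl fun a _ => Finset.sum_congr rfl fun b _ => by ring
  obtain ⟨f, hf⟩ := hconv.exists_forall_hasFDerivAt_of_fderiv_symmetric hW
    (hsmooth.differentiableOn hk') (fun t ht x y => by
      rw [hfd t ht, hfd t ht, Finset.sum_comm]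
      refine Finset.sum_congr rfl fun a _ => Finset.sum_congr rfl fun b _ => ?_
      rw [hclosed t ht a b]
      ring)
  refine ⟨f, ?_, fun t ht a => ?_⟩
  · rw [Nat.cast_add, Nat.cast_one, contDiffOn_succ_iff_fderiv_of_isOpen hW]
    refine ⟨fun t ht => (hf t ht).differentiableAt.differentiableWithinAt, by simp, ?_⟩
    exact hsmooth.congr fun t ht => (hf t ht).fderiv
  · rw [pderiv, (hf t ht).fderiv, hform]
    simp [Pi.single_apply]

/-- A symmetric tensor with symmetric derivatives is a tensor of third derivatives. -/
lemma exists_third_eq (hW : IsOpen W) (hconv : Convex ℝ W)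
    {T : Fin 3 → Fin 3 → Fin 3 → (Fin 3 → ℝ) → ℝ} (hT : ∀ a b c, ContDiffOn ℝ 1 (T a b c) W)
    (h12 : ∀ a b c, T a b c = T b a c) (h23 : ∀ a b c, T a b c = T a c b)
    (hclosed : ∀ t ∈ W, ∀ d a b c, pderiv d (T a b c) t = pderiv a (T d b c) t) :
    ∃ F, ContDiffOn ℝ 4 F W ∧ ∀ t ∈ W, ∀ a b c, third F a b c t = T a b c t := by
  choose G hG hGT using fun b c => exists_potential hW hconv (k := 1) one_ne_zero
    (ω := fun a => T a b c) (fun a => by simpa using hT a b c)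
    (fun t ht a d => hclosed t ht a d b c)
  -- The potentials `G b c` and `G c b` are chosen separately and may differ by a constant. One
  -- choice per unordered pair gives exact symmetry, which the last integration requires.
  set K : Fin 3 → Fin 3 → (Fin 3 → ℝ) → ℝ := fun b c => if b ≤ c then G b c else G c b with hK
  have hKsymm : ∀ b c, K b c = K c b := by
    intro b c
    rcases lt_trichotomy b c with h | h | h
    · simp [hK, h.le, h.not_ge]
    · rw [h]
    · simp [hK, h.le, h.not_ge]
  have hKd : ∀ b c, ContDiffOn ℝ 2 (K b c) W := by
    intro b c
    simp only [hK]
    split_ifs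
    · exact hG b c
    · exact hG c b
  have hKT : ∀ b c, ∀ t ∈ W, ∀ a, pderiv a (K b c) t = T a b c t := by
    intro b c t ht a
    simp only [hK]
    split_ifs
    · exact hGT b c t ht a
    · rw [h23]
      exact hGT c b t ht a
  choose H hH hHK using fun c => exists_potential hW hconv (k := 2) two_ne_zero
    (ω := fun b => K b c) (fun b => hKd b c)
    (fun t ht a b => by rw [hKT b c t ht, hKT a c t ht, h12])
  obtain ⟨F, hF, hFH⟩ := exists_potential hW hconv (k := 3) three_ne_zero (ω := H) hH
    (fun t ht b c => by rw [hHK c t ht, hHK b t ht, hKsymm])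
  refine ⟨F, hF, fun t ht a b c => ?_⟩
  have h1 : ∀ s ∈ W, pderiv b (pderiv c F) s = K b c s := fun s hs => by
    rw [pderiv_congr hW (fun r hr => hFH r hr c) b s hs, hHK c s hs]
  rw [third, pderiv_congr hW h1 a t ht, hKT b c t ht]

lemma third_symm (hW : IsOpen W) {F : (Fin 3 → ℝ) → ℝ} (hF : ContDiffOn ℝ 4 F W) :
    ∀ t ∈ W, ∀ a b c, third F a b c t = third F b a c t ∧ third F a b c t = third F a c b t := by
  intro t ht a b c
  refine ⟨pderiv_comm hW (ContDiffOn.pderiv hW hF (by norm_num) c) a b t ht, ?_⟩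
  exact pderiv_congr hW (pderiv_comm hW (hF.of_le (by norm_num)) b c) a t ht

end Calculus

lemma contDiff_det {n : ℕ} {E : Type*} [NormedAddCommGroup E] [NormedSpace ℝ E]
    {M : E → Matrix (Fin n) (Fin n) ℝ} (hM : ∀ i j, ContDiff ℝ 1 fun x => M x i j) :
    ContDiff ℝ 1 fun x => (M x).det := by
  simp only [Matrix.det_apply']
  exact ContDiff.sum fun σ _ => contDiff_const.mul (contDiff_prod fun i _ => hM _ _)

namespace LineCongruence

variable {n : ℕ} (C : LineCongruence n)

lemma contDiff_psiMat (i j : Fin n) : ContDiff ℝ 1 fun u => C.psiMat u i j := by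
  simp only [psiMat, Matrix.of_apply]
  fun_prop

/-- By Cramer's rule the flux is a quotient of determinants with smooth entries. -/
lemma contDiffOn_flux (i : Fin n) : ContDiffOn ℝ 1 (fun u => C.flux u i) C.regular := by
  have h : ∀ u, C.flux u i = (C.psiMat u).det⁻¹ *
      ((C.psiMat u).updateCol i (C.theta *ᵥ u + C.xi)).det := by
    intro u
    rw [← Matrix.cramer_apply, Matrix.cramer_eq_adjugate_mulVec, flux, Matrix.inv_def,
      Ring.inverse_eq_inv', Matrix.smul_mulVec]
    rfl
  simp only [h]
  refine ((contDiff_det C.contDiff_psiMat).contDiffOn.inv fun u hu => hu).mul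
    (contDiff_det fun a b => ?_).contDiffOn
  by_cases hb : b = i
  · subst hb
    simp only [Matrix.updateCol_self, Pi.add_apply, Matrix.mulVec, dotProduct]
    fun_prop
  · simp only [Matrix.updateCol_ne hb]
    exact C.contDiff_psiMat a b

end LineCongruence

variable {η : Matrix (Fin 3) (Fin 3) ℝ} {W : Set (Fin 3 → ℝ)} {F : (Fin 3 → ℝ) → ℝ}

lemma solvesWDVV_iff (hsymm : η.IsSymm) (hdet : η.det ≠ 0) (hW : IsOpen W)
    (hF : IsNormalized η W F) :
    SolvesWDVV η W F ↔ ∀ t ∈ W, (wdvvCongruence η).Holds (fields F 1 t) (fields F 2 t) :=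
  forall₂_congr fun t ht => wdvv_tensor_iff hsymm hdet (T := fun a b c => third F a b c t)
    (fun a b c => (third_symm hW hF.1 t ht a b c).1)
    (fun a b c => (third_symm hW hF.1 t ht a b c).2) (fun a b => hF.2 t ht a b)

lemma psi_chosenCongruence_skew (η : Matrix (Fin 3) (Fin 3) ℝ) (p γ i k : Fin 3) :
    (chosenCongruence η p).psi γ k i = -(chosenCongruence η p).psi γ i k := by
  unfold chosenCongruence
  split_ifs <;> exact psi_wdvvCongruence_skew η γ i k

variable {p q : Fin 3} (hpq : (p = 1 ∧ q = 2) ∨ (p = 2 ∧ q = 1))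
include hpq

lemma solvesWDVV_iff_chosenCongruence (hsymm : η.IsSymm) (hdet : η.det ≠ 0) (hW : IsOpen W)
    (hF : IsNormalized η W F) :
    SolvesWDVV η W F ↔
      ∀ t ∈ W, (chosenCongruence η p).Holds (fields F p t) (fields F q t) := by
  rw [solvesWDVV_iff hsymm hdet hW hF]
  rcases hpq with ⟨rfl, rfl⟩ | ⟨rfl, rfl⟩
  · rfl
  · exact forall₂_congr fun t _ => LineCongruence.swap_holds_iff.symm

omit hpq in
lemma contDiffOn_fields (hW : IsOpen W) (hF : ContDiffOn ℝ 4 F W) (p I : Fin 3) :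
    ContDiffOn ℝ 1 (fun t => fields F p t I) W := by
  have h : ∀ a b c, ContDiffOn ℝ 1 (third F a b c) W := fun a b c =>
    ContDiffOn.pderiv hW (ContDiffOn.pderiv (k := 2) hW (ContDiffOn.pderiv (k := 3) hW hF
      (by norm_num) c) (by norm_num) b) (by norm_num) a
  fin_cases I <;> exact h _ _ _

/-- Near a regular point the flux equals `fields F q`, so the law is the equality of mixed partial
derivatives `∂_q F_{pbc} = ∂_p F_{qbc}`. -/
lemma conservationLawAt_fields (hsymm : η.IsSymm) (hdet : η.det ≠ 0) (hW : IsOpen W)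
    (hF : IsNormalized η W F) (hS : SolvesWDVV η W F) {t : Fin 3 → ℝ} (ht : t ∈ W)
    (hreg : fields F p t ∈ (chosenCongruence η p).regular) :
    ConservationLawAt p q (chosenCongruence η p).flux (fields F p) t := by
  intro I
  have hcont : ContinuousOn (fields F p) W :=
    continuousOn_pi.2 fun I => (contDiffOn_fields hW hF.1 p I).continuousOn
  have hopen : IsOpen (W ∩ fields F p ⁻¹' (chosenCongruence η p).regular) :=
    hcont.isOpen_inter_preimage hW (LineCongruence.isOpen_regular _)
  have hflux : ∀ s ∈ W ∩ fields F p ⁻¹' (chosenCongruence η p).regular,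
      (chosenCongruence η p).flux (fields F p s) I = fields F q s I := fun s hs => by
    rw [← (LineCongruence.holds_iff_eq_flux (psi_chosenCongruence_skew η p) hs.2 _).1
      ((solvesWDVV_iff_chosenCongruence hpq hsymm hdet hW hF).1 hS s hs.1)]
  rw [pderiv_congr hopen hflux p t ⟨ht, hreg⟩]
  have h : ∀ b c, pderiv q (third F p b c) t = pderiv p (third F q b c) t := fun b c =>
    pderiv_comm hW (ContDiffOn.pderiv hW (ContDiffOn.pderiv (k := 3) hW hF.1
      (by norm_num) c) (by norm_num) b) q p t ht
  fin_cases I <;> exact h _ _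

omit hpq in
/-- Reconstruction of a solution of the WDVV equations from its third derivatives
`F_{222}, F_{223}, F_{233}, F_{333}`. -/
lemma exists_solution (hsymm : η.IsSymm) (hdet : η.det ≠ 0) (hW : IsOpen W) (hconv : Convex ℝ W)
    {g : ℕ → (Fin 3 → ℝ) → ℝ} (hg : ∀ k, ContDiffOn ℝ 1 (g k) W)
    (hg0 : ∀ k, ∀ t ∈ W, pderiv 0 (g k) t = 0)
    (hg12 : ∀ k < 3, ∀ t ∈ W, pderiv 2 (g k) t = pderiv 1 (g (k + 1)) t)
    (hH : ∀ t ∈ W, (wdvvCongruence η).Holds ![g 0 t, g 1 t, g 2 t] ![g 1 t, g 2 t, g 3 t]) :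
    ∃ F, IsNormalized η W F ∧ SolvesWDVV η W F ∧ (∀ t ∈ W, fields F 1 t = ![g 0 t, g 1 t, g 2 t]) ∧
      ∀ t ∈ W, fields F 2 t = ![g 1 t, g 2 t, g 3 t] := by
  -- For nonzero indices, `a + b + c - 3` counts those equal to `2`, that is, the derivatives in
  -- `t³`; thus `g 0, ..., g 3` are `F_{222}, ..., F_{333}`.
  set T : Fin 3 → Fin 3 → Fin 3 → (Fin 3 → ℝ) → ℝ := fun a b c =>
    if a = 0 then fun _ => η b c else if b = 0 then fun _ => η a c else
      if c = 0 then fun _ => η a b else g (a.val + b.val + c.val - 3) with hT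
  have hη : ∀ i j, η i j = η j i := fun i j => (hsymm.apply i j).symm
  have hT0 : ∀ a b, T 0 a b = fun _ => η a b := fun a b => by simp [hT]
  have h12 : ∀ a b c, T a b c = T b a c := by
    intro a b c
    by_cases ha : a = 0 <;> by_cases hb : b = 0 <;> by_cases hc : c = 0 <;>
      simp [hT, ha, hb, hc, hη b a, hη b 0, hη a 0, add_comm a.val]
  have h23 : ∀ a b c, T a b c = T a c b := by
    intro a b c
    by_cases ha : a = 0 <;> by_cases hb : b = 0 <;> by_cases hc : c = 0 <;>
      simp [hT, ha, hb, hc, hη c b, hη 0 b, hη 0 c, add_right_comm _ c.val]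
  have hcase : ∀ a b c, (∃ r, T a b c = fun _ => r) ∨ ∃ k, T a b c = g k := by
    intro a b c
    simp only [hT]
    split_ifs
    exacts [Or.inl ⟨_, rfl⟩, Or.inl ⟨_, rfl⟩, Or.inl ⟨_, rfl⟩, Or.inr ⟨_, rfl⟩]
  have hconst : ∀ a (r : ℝ) t, pderiv a (fun _ => r) t = 0 := fun a r t => by simp [pderiv]
  have hTsmooth : ∀ a b c, ContDiffOn ℝ 1 (T a b c) W := by
    intro a b c
    rcases hcase a b c with ⟨r, h⟩ | ⟨k, h⟩
    · rw [h]
      exact contDiffOn_const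
    · rw [h]
      exact hg k
  have hTd0 : ∀ a b c, ∀ t ∈ W, pderiv 0 (T a b c) t = 0 := by
    intro a b c t ht
    rcases hcase a b c with ⟨r, h⟩ | ⟨k, h⟩
    · rw [h, hconst]
    · rw [h, hg0 k t ht]
  -- The only closedness condition with content: those involving the index `0` hold because the
  -- entries `T 0 b c` are constant and nothing depends on `t¹`.
  have h21 : ∀ t ∈ W, ∀ b c, pderiv 2 (T 1 b c) t = pderiv 1 (T 2 b c) t := by
    intro t ht b c
    by_cases hb : b = 0
    · rw [hb, h12 1, h12 2, hT0, hT0, hconst, hconst]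
    by_cases hc : c = 0
    · rw [hc, h23 1, h23 2, h12 1, h12 2, hT0, hT0, hconst, hconst]
    have hb' : b.val ≠ 0 := fun h => hb (Fin.ext h)
    have hc' : c.val ≠ 0 := fun h => hc (Fin.ext h)
    have h1 : T 1 b c = g (b.val + c.val - 2) := by
      simp only [hT, one_ne_zero, hb, hc, if_false]
      congr 1
      simp
      omega
    have h2 : T 2 b c = g (b.val + c.val - 2 + 1) := by
      simp only [hT, hb, hc, if_false]
      rw [if_neg (by decide)]
      congr 1
      simp
      omega
    rw [h1, h2]
    exact hg12 _ (by omega) t ht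
  obtain ⟨F, hF, hFT⟩ := exists_third_eq hW hconv hTsmooth h12 h23 (by
    intro t ht d a b c
    have cases : ∀ i : Fin 3, i = 0 ∨ i = 1 ∨ i = 2 := by decide
    by_cases ha : a = 0
    · rw [ha, hT0, hconst, hTd0 _ _ _ t ht]
    by_cases hd : d = 0
    · rw [hd, hT0, hconst, hTd0 _ _ _ t ht]
    rcases (cases a).resolve_left ha with rfl | rfl <;>
      rcases (cases d).resolve_left hd with rfl | rfl
    exacts [rfl, h21 t ht b c, (h21 t ht b c).symm, rfl])
  have hf1 : ∀ t ∈ W, fields F 1 t = ![g 0 t, g 1 t, g 2 t] := by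
    intro t ht
    simp only [fields, hFT t ht]
    rfl
  have hf2 : ∀ t ∈ W, fields F 2 t = ![g 1 t, g 2 t, g 3 t] := by
    intro t ht
    simp only [fields, hFT t ht]
    rfl
  have hN : IsNormalized η W F := ⟨hF, fun t ht a b => by rw [hFT t ht, hT0]⟩
  refine ⟨F, hN, (solvesWDVV_iff hsymm hdet hW hN).2 fun t ht => ?_, hf1, hf2⟩
  rw [hf1 t ht, hf2 t ht]
  exact hH t ht

omit hpq in
lemma wdvvCongruence_holds_shift {u v : Fin 3 → ℝ} (h : (wdvvCongruence η).Holds u v) :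
    v 0 = u 1 ∧ v 1 = u 2 := by
  have h0 := h 0
  have h1 := h 1
  simp [wdvvCongruence, Fin.sum_univ_three] at h0 h1
  exact ⟨by linarith, by linarith⟩

/-- By `wdvvCongruence_holds_shift`, `u` and its flux `v` overlap in two entries and together give
four functions, the candidates for `F_{222}, F_{223}, F_{233}, F_{333}`. The three laws become their
compatibility conditions, and the congruence holds by the definition of the flux. -/
lemma exists_solution_of_conservationLaw (hsymm : η.IsSymm) (hdet : η.det ≠ 0) (hW : IsOpen W)
    (hconv : Convex ℝ W) {u : (Fin 3 → ℝ) → Fin 3 → ℝ} (hu : ContDiffOn ℝ 1 u W)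
    (hu0 : ∀ t ∈ W, ∀ I, pderiv 0 (fun s => u s I) t = 0)
    (hreg : ∀ t ∈ W, u t ∈ (chosenCongruence η p).regular)
    (hlaw : ∀ t ∈ W, ConservationLawAt p q (chosenCongruence η p).flux u t) :
    ∃ F, IsNormalized η W F ∧ SolvesWDVV η W F ∧ ∀ t ∈ W, fields F p t = u t := by
  set v : (Fin 3 → ℝ) → Fin 3 → ℝ := fun t => (chosenCongruence η p).flux (u t) with hv
  have hholds : ∀ t ∈ W, (chosenCongruence η p).Holds (u t) (v t) := fun t ht =>
    (LineCongruence.holds_iff_eq_flux (psi_chosenCongruence_skew η p) (hreg t ht) _).2 rfl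
  have huI : ∀ I, ContDiffOn ℝ 1 (fun t => u t I) W := fun I => contDiffOn_pi.1 hu I
  have hvI : ∀ I, ContDiffOn ℝ 1 (fun t => v t I) W := fun I =>
    (LineCongruence.contDiffOn_flux _ I).comp hu hreg
  have hv0 : ∀ t ∈ W, ∀ I, pderiv 0 (fun s => v s I) t = 0 := by
    intro t ht I
    have hV : DifferentiableAt ℝ (fun w => (chosenCongruence η p).flux w I) (u t) :=
      ((LineCongruence.contDiffOn_flux _ I).contDiffAt
        ((LineCongruence.isOpen_regular _).mem_nhds (hreg t ht))).differentiableAt (by simp)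
    have hd : DifferentiableAt ℝ u t :=
      (hu.contDiffAt (hW.mem_nhds ht)).differentiableAt (by simp)
    have hz : fderiv ℝ u t (Pi.single 0 1) = 0 := by
      funext J
      have hJ := hu0 t ht J
      rw [pderiv, (hasFDerivAt_pi'.1 hd.hasFDerivAt J).fderiv] at hJ
      exact hJ
    change fderiv ℝ ((fun w => (chosenCongruence η p).flux w I) ∘ u) t _ = 0
    rw [fderiv_comp t hV hd, ContinuousLinearMap.comp_apply, hz, map_zero]
  have hlaw' : ∀ t ∈ W, ∀ I, pderiv q (fun s => u s I) t = pderiv p (fun s => v s I) t := hlaw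
  clear_value v
  rcases hpq with ⟨rfl, rfl⟩ | ⟨rfl, rfl⟩
  · change ∀ t ∈ W, (wdvvCongruence η).Holds (u t) (v t) at hholds
    have hs := fun t ht => wdvvCongruence_holds_shift (hholds t ht)
    have hl0 := pderiv_congr hW (fun t ht => (hs t ht).1) 1
    have hl1 := pderiv_congr hW (fun t ht => (hs t ht).2) 1
    obtain ⟨F, hN, hS, hf, -⟩ := exists_solution hsymm hdet hW hconv
      -- For `p = 1`, `u` supplies the first three third derivatives and the flux supplies
      -- `F_{333}`.
      (g := fun k => match k with
        | 0 => fun t => u t 0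
        | 1 => fun t => u t 1
        | 2 => fun t => u t 2
        | _ => fun t => v t 2)
      (fun k => by split; exacts [huI 0, huI 1, huI 2, hvI 2])
      (fun k t ht => by
        split
        exacts [hu0 t ht 0, hu0 t ht 1, hu0 t ht 2, hv0 t ht 2])
      (fun k hk t ht => by
        interval_cases k
        exacts [(hlaw' t ht 0).trans (hl0 t ht), (hlaw' t ht 1).trans (hl1 t ht), hlaw' t ht 2])
      (fun t ht => by
        convert hholds t ht using 1
        · funext i; fin_cases i <;> rfl
        · funext i; fin_cases i
          exacts [(hs t ht).1.symm, (hs t ht).2.symm, rfl])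
    refine ⟨F, hN, hS, fun t ht => (hf t ht).trans ?_⟩
    funext i; fin_cases i <;> rfl
  · replace hholds : ∀ t ∈ W, (wdvvCongruence η).Holds (v t) (u t) := fun t ht =>
      LineCongruence.swap_holds_iff.1 (hholds t ht)
    have hs := fun t ht => wdvvCongruence_holds_shift (hholds t ht)
    have hl0 := pderiv_congr hW (fun t ht => (hs t ht).1) 2
    have hl1 := pderiv_congr hW (fun t ht => (hs t ht).2) 2
    obtain ⟨F, hN, hS, -, hf⟩ := exists_solution hsymm hdet hW hconv
      -- For `p = 2`, `u` supplies the last three third derivatives and the flux supplies `F_{222}`.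
      (g := fun k => match k with
        | 0 => fun t => v t 0
        | 1 => fun t => u t 0
        | 2 => fun t => u t 1
        | _ => fun t => u t 2)
      (fun k => by split; exacts [hvI 0, huI 0, huI 1, huI 2])
      (fun k t ht => by
        split
        exacts [hv0 t ht 0, hu0 t ht 0, hu0 t ht 1, hu0 t ht 2])
      (fun k hk t ht => by
        interval_cases k
        exacts [(hlaw' t ht 0).symm, (hl0 t ht).trans (hlaw' t ht 1).symm,
          (hl1 t ht).trans (hlaw' t ht 2).symm])
      (fun t ht => by
        convert hholds t ht using 1
        · funext i; fin_cases i
          exacts [rfl, (hs t ht).1, (hs t ht).2]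
        · funext i; fin_cases i <;> rfl)
    refine ⟨F, hN, hS, fun t ht => (hf t ht).trans ?_⟩
    funext i; fin_cases i <;> rfl

end

end WDVV

end

theorem mainTheorem9 (η : Matrix (Fin 3) (Fin 3) ℝ) (hsymm : η.IsSymm) (hdet : η.det ≠ 0)
    (p q : Fin 3) (hpq : (p = 1 ∧ q = 2) ∨ (p = 2 ∧ q = 1)) :
    -- `φ` and `ψ` are nondegenerate
    (WDVV.phi η).det ≠ 0 ∧
    IsOpen (WDVV.chosenCongruence η p).regular ∧
    Dense (WDVV.chosenCongruence η p).regular ∧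
    -- the WDVV system is the linear line congruence
    (∀ (W : Set (Fin 3 → ℝ)) (F : (Fin 3 → ℝ) → ℝ), IsOpen W → WDVV.IsNormalized η W F →
      (WDVV.SolvesWDVV η W F ↔ ∀ t ∈ W,
        (WDVV.chosenCongruence η p).Holds (WDVV.fields F p t) (WDVV.fields F q t))) ∧
    -- the congruence can be solved for the fluxes
    (∀ u ∈ (WDVV.chosenCongruence η p).regular, ∀ v : Fin 3 → ℝ,
      (WDVV.chosenCongruence η p).Holds u v ↔ v = (WDVV.chosenCongruence η p).flux u) ∧
    -- solutions of the WDVV system give solutions of the system of conservation laws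
    (∀ (W : Set (Fin 3 → ℝ)) (F : (Fin 3 → ℝ) → ℝ), IsOpen W → WDVV.IsNormalized η W F →
      WDVV.SolvesWDVV η W F →
      ∀ t ∈ W, WDVV.fields F p t ∈ (WDVV.chosenCongruence η p).regular →
        WDVV.ConservationLawAt p q (WDVV.chosenCongruence η p).flux (WDVV.fields F p) t) ∧
    -- and conversely
    (∀ (W : Set (Fin 3 → ℝ)) (u : (Fin 3 → ℝ) → Fin 3 → ℝ), IsOpen W → Convex ℝ W →
      ContDiffOn ℝ 1 u W → (∀ t ∈ W, ∀ I, WDVV.pderiv 0 (fun s => u s I) t = 0) →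
      (∀ t ∈ W, u t ∈ (WDVV.chosenCongruence η p).regular) →
      (∀ t ∈ W, WDVV.ConservationLawAt p q (WDVV.chosenCongruence η p).flux u t) →
      ∃ F : (Fin 3 → ℝ) → ℝ, WDVV.IsNormalized η W F ∧ WDVV.SolvesWDVV η W F ∧
        ∀ t ∈ W, WDVV.fields F p t = u t) ∧
    -- the Monge metric defines a third-order Hamiltonian operator
    WDVV.IsThirdOrderHamiltonian (WDVV.chosenCongruence η p).regular
      ((WDVV.chosenCongruence η p).monge (WDVV.phi η)) ∧
    -- with respect to which the system of conservation laws is Hamiltonian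
    WDVV.IsHamiltonianSystem (WDVV.chosenCongruence η p).regular
      ((WDVV.chosenCongruence η p).monge (WDVV.phi η)) (WDVV.chosenCongruence η p).flux := by
  have hM : (WDVV.chosenCongruence η p).IsMongeSystem (WDVV.phi η) := by
    unfold WDVV.chosenCongruence
    split_ifs
    exacts [(WDVV.isMongeSystem_wdvv hsymm hdet).1, (WDVV.isMongeSystem_wdvv hsymm hdet).2]
  exact ⟨WDVV.det_phi_ne_zero hsymm hdet, WDVV.LineCongruence.isOpen_regular _,
    WDVV.dense_regular hsymm hdet p,
    fun _ _ hW hF => WDVV.solvesWDVV_iff_chosenCongruence hpq hsymm hdet hW hF,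
    fun _ hu v => WDVV.LineCongruence.holds_iff_eq_flux hM.skew hu v,
    fun _ _ hW hF hS _ ht hreg =>
      WDVV.conservationLawAt_fields hpq hsymm hdet hW hF hS ht hreg,
    fun _ _ hW hconv hu hu0 hreg hlaw =>
      WDVV.exists_solution_of_conservationLaw hpq hsymm hdet hW hconv hu hu0 hreg hlaw,
    hM.toIsMonge.isThirdOrderHamiltonian, hM.isHamiltonianSystem⟩
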